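/- **Divergence lemma.** Let $S\subseteq\mathbb R^d$ and let $\mu$ be a probability measure on $S$. Let $(P_t)_{t\ge0}$ be the transition semigroup on $L^2(\mu)$ of a $\mu$-reversible Markov process with state space $S$, i.e. a strongly continuous semigroup of symmetric, positivity preserving operators with $P_t1=1$, and let $(L,\mathrm{Dom}(L))$ be its generator. Let $\mathcal E$, with $\mathcal E(f)=\mathcal E(f,f)$, be the associated Dirichlet form, i.e. the closed extension of $-\int_S fLf\,d\mu$, $f\in\mathrm{Dom}(L)$, to the closure $\mathrm{Dom}(\mathcal E)$ of $\mathrm{Dom}(L)$ in the norm $\|f\|_{L^2(\mu)}+\mathcal E(f)^{1/2}$. Assume that $C^\infty(S)\cap\mathrm{Dom}(L)$ is a core of $L$. For $T\in(0,\infty)$ let $\lambda$ be the Lebesgue measure on $[0,T]$, and for $u\in L^2(\lambda\otimes\mu)$ with $u(t,\cdot)\in\mathrm{Dom}(\mathcal E)$ for a.e. $t\in[0,T]$ let $\mathcal E_T(u)=\int_0^T\mathcal E(u(t,\cdot))\,dt$. The operator $L$ acts on the space variable, $\partial_t$ is the weak time derivative, and norms without index are those of $L^2(\lambda\otimes\mu)$.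 Let $H^{1,2}_D$ and $H^{2,2}_D$ be the closures in $L^2(\lambda\otimes\mu)$, with respect to the norms $$\|u\|_{1,2}=\|u\|+\mathcal E_T(u)^{1/2}+\|\partial_tu\|,$$ $$\|u\|_{2,2}=\|u\|+\mathcal E_T(u)^{1/2}+\|\partial_tu\|+\|Lu\|+\|\partial_{tt}u\|+\mathcal E_T(\partial_tu)^{1/2},$$ respectively, of the set of those $u\in C^\infty([0,T]\times S)\cap L^2(\lambda\otimes\mu)$ with $u(0,\cdot)=u(T,\cdot)=0$ for which the respective norm is defined and finite. Then there is a universal constant $C\in(0,\infty)$ (independent of $d,S,\mu,L,m,T$) with the following property. Suppose that $L$ has purely discrete spectrum on $L^2(\mu)$ (the spectrum consists of isolated eigenvalues of finite multiplicity) and that, for some $m>0$, the Poincaré inequality $$\|f-\mu(f)\|_{L^2(\mu)}^2\le\frac1m\,\mathcal E(f)\qquad\text{for all }f\in\mathrm{Dom}(\mathcal E)$$ holds. Then for every $T\in(0,\infty)$ and every $f\in L^2(\lambda\otimes\mu)$ with $\int f\,d(\lambda\otimes\mu)=0$ there are $h\in H^{1,2}_D$ and $g\in H^{2,2}_D$ with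 $$\partial_th-2Lg=f$$ and $$\|2Lg\|\le C\|f\|,\qquad\sqrt{2\mathcal E_T(h)}\le C\|f\|,\qquad\sqrt{2\mathcal E_T(\partial_tg)}\le C\bigl(1+T^{-1}m^{-1/2}\bigr)\|f\|.$$ -/

import Mathlib

open MeasureTheory Set Filter Topology
open scoped NNReal ENNReal ContDiff

noncomputable section

namespace DivLemma

/-! ### Reversible Markov semigroups on `L²(μ)` and their generators -/

/-- The transition semigroup on `L²(μ)` of a `μ`-reversible Markov process: a strongly continuous
semigroup of symmetric, positivity preserving operators that fix the constants. -/
structure ReversibleSemigroup {X : Type*} [MeasurableSpace X] (μ : Measure X)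
    [IsProbabilityMeasure μ] where
  P : ℝ≥0 → (Lp ℝ 2 μ →L[ℝ] Lp ℝ 2 μ)
  zero' : P 0 = ContinuousLinearMap.id ℝ (Lp ℝ 2 μ)
  add' : ∀ s t f, P (s + t) f = P s (P t f)
  continuous' : ∀ f, Tendsto (fun t => P t f) (𝓝 0) (𝓝 f)
  symm' : ∀ t f g, inner ℝ (P t f) g = inner ℝ f (P t g)
  nonneg' : ∀ t f, 0 ≤ f → 0 ≤ P t f
  one' : ∀ t, P t (Lp.const 2 μ (1 : ℝ)) = Lp.const 2 μ (1 : ℝ)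

section Generator

variable {X : Type*} [MeasurableSpace X] {μ : Measure X} [IsProbabilityMeasure μ]

/-- `f` lies in the domain of the generator and the generator maps it to `l`. -/
def ReversibleSemigroup.HasGenerator (Q : ReversibleSemigroup μ) (f l : Lp ℝ 2 μ) : Prop :=
  Tendsto (fun t : ℝ≥0 => (t : ℝ)⁻¹ • (Q.P t f - f)) (𝓝[>] 0) (𝓝 l)

theorem ReversibleSemigroup.HasGenerator.add {Q : ReversibleSemigroup μ} {f g l k : Lp ℝ 2 μ}
    (hf : Q.HasGenerator f l) (hg : Q.HasGenerator g k) : Q.HasGenerator (f + g) (l + k) := by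
  refine (Tendsto.add hf hg).congr fun t => ?_
  rw [map_add, ← smul_add]
  congr 1
  abel

theorem ReversibleSemigroup.HasGenerator.smul {Q : ReversibleSemigroup μ} {f l : Lp ℝ 2 μ}
    (c : ℝ) (hf : Q.HasGenerator f l) : Q.HasGenerator (c • f) (c • l) := by
  refine (Tendsto.const_smul hf c).congr fun t => ?_
  rw [map_smul, ← smul_sub, smul_comm]

theorem ReversibleSemigroup.HasGenerator.unique {Q : ReversibleSemigroup μ} {f l k : Lp ℝ 2 μ}
    (h : Q.HasGenerator f l) (h' : Q.HasGenerator f k) : l = k :=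
  tendsto_nhds_unique h h'

/-- The generator `(L, dom L)` of the semigroup in `L²(μ)`: `L f = lim_{t ↓ 0} (P_t f - f) / t`,
with domain the set of all `f` for which the limit exists in `L²(μ)`. -/
def ReversibleSemigroup.generator (Q : ReversibleSemigroup μ) : Lp ℝ 2 μ →ₗ.[ℝ] Lp ℝ 2 μ where
  domain :=
    { carrier := {f | ∃ l, Q.HasGenerator f l}
      add_mem' := fun ⟨l, hl⟩ ⟨k, hk⟩ => ⟨l + k, hl.add hk⟩
      zero_mem' := ⟨0, by simp [ReversibleSemigroup.HasGenerator]⟩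
      smul_mem' := fun c _ ⟨l, hl⟩ => ⟨c • l, hl.smul c⟩ }
  toFun :=
    { toFun := fun f => f.2.choose
      map_add' := fun f g =>
        (f + g).2.choose_spec.unique (f.2.choose_spec.add g.2.choose_spec)
      map_smul' := fun c f => (c • f).2.choose_spec.unique (f.2.choose_spec.smul c) }

end Generator

/-! ### Spectrum and quadratic form of a partially defined operator -/

section Operator

variable {H : Type*} [NormedAddCommGroup H] [InnerProductSpace ℝ H]

/-- `z` lies in the resolvent set of `A`: `z - A : dom A → H` has a bounded inverse. -/
def IsResolventPoint (A : H →ₗ.[ℝ] H) (z : ℝ) : Prop :=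
  ∃ R : H →L[ℝ] H,
    (∀ f : H, ∃ hf : R f ∈ A.domain, z • R f - A ⟨R f, hf⟩ = f) ∧
    ∀ u : A.domain, R (z • (u : H) - A u) = u

/-- The (real) spectrum of `A`. -/
def spec (A : H →ₗ.[ℝ] H) : Set ℝ := {z | ¬ IsResolventPoint A z}

/-- The eigenspace `{u ∈ dom A | A u = z u}`. -/
def eigenspace (A : H →ₗ.[ℝ] H) (z : ℝ) : Submodule ℝ A.domain :=
  LinearMap.ker (A.toFun - z • A.domain.subtype)

/-- Purely discrete spectrum: the spectrum consists of isolated points, each of which is an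
eigenvalue of finite multiplicity. -/
def HasPurelyDiscreteSpectrum (A : H →ₗ.[ℝ] H) : Prop :=
  ∀ z ∈ spec A,
    (∃ ε : ℝ, 0 < ε ∧ ∀ w ∈ spec A, |w - z| < ε → w = z) ∧
    eigenspace A z ≠ ⊥ ∧ FiniteDimensional ℝ (eigenspace A z)

/-- The quadratic form `-⟨u, A u⟩` on `dom A`. -/
def preForm (A : H →ₗ.[ℝ] H) (u : A.domain) : ℝ := -inner ℝ (u : H) (A u)

/-- `u n ∈ dom A` converges to `f` in `H` and is Cauchy for the quadratic form of `A`. -/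
def IsFormApprox (A : H →ₗ.[ℝ] H) (u : ℕ → A.domain) (f : H) : Prop :=
  Tendsto (fun n => (u n : H)) atTop (𝓝 f) ∧
  Tendsto (fun p : ℕ × ℕ => preForm A (u p.1 - u p.2)) atTop (𝓝 0)

/-- The Dirichlet form `ℰ(f) = ℰ(f, f)` of `A`, i.e. the closed extension of `-⟨f, A f⟩` to the
closure `dom ℰ` of `dom A` in the norm `‖f‖ + ℰ(f)^{1/2}`. It is extended by `∞` off `dom ℰ`
(an infimum over the empty set); on `dom ℰ` exactly one `e` is admissible when the form is
closable, which is the case for `A` symmetric and nonpositive. -/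
def energy (A : H →ₗ.[ℝ] H) (f : H) : ℝ≥0∞ :=
  ⨅ (e : ℝ) (_ : ∃ u : ℕ → A.domain, IsFormApprox A u f ∧
    Tendsto (fun n => preForm A (u n)) atTop (𝓝 e)), ENNReal.ofReal e

end Operator

/-- Poincaré inequality with constant `1 / m`: `‖f - μ(f)‖² ≤ (1 / m) ℰ(f)` for `f ∈ dom ℰ`
(for `f` outside of `dom ℰ` the right-hand side is infinite). -/
def PoincareInequality {X : Type*} [MeasurableSpace X] (μ : Measure X)
    (A : Lp ℝ 2 μ →ₗ.[ℝ] Lp ℝ 2 μ) (m : ℝ) : Prop :=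
  ∀ f : Lp ℝ 2 μ, ENNReal.ofReal (∫ x, (f x - ∫ y, f y ∂μ) ^ 2 ∂μ)
    ≤ ENNReal.ofReal (1 / m) * energy A f

/-! ### Space-time functions -/

/-- `λ ⊗ μ`, with `λ` the Lebesgue measure on `[0, T]`. -/
abbrev spaceTime {X : Type*} [MeasurableSpace X] (T : ℝ) (μ : Measure X) : Measure (ℝ × X) :=
  ((volume : Measure ℝ).restrict (Icc 0 T)).prod μ

section SpaceTime

variable {X : Type*} [MeasurableSpace X] {μ : Measure X} {T : ℝ}

open Classical in
/-- The function `u(t, ·)` as an element of `L²(μ)`; it is in `L²(μ)` for a.e. `t ∈ [0, T]`, and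
the value is `0` for the other `t`. -/
def slice (u : Lp ℝ 2 (spaceTime T μ)) (t : ℝ) : Lp ℝ 2 μ :=
  if h : MemLp (fun x => u (t, x)) 2 μ then h.toLp else 0

/-- The time-integrated Dirichlet form `ℰ_T(u) = ∫₀ᵀ ℰ(u(t, ·)) dt`. -/
def timeEnergy (A : Lp ℝ 2 μ →ₗ.[ℝ] Lp ℝ 2 μ) (u : Lp ℝ 2 (spaceTime T μ)) : ℝ≥0∞ :=
  ∫⁻ t in Icc 0 T, energy A (slice u t)

/-- `v = ∂ₜ u` in the weak sense on `(0, T)`. -/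
def HasTimeDeriv (u v : Lp ℝ 2 (spaceTime T μ)) : Prop :=
  ∀ (η : ℝ → ℝ) (ψ : Lp ℝ 2 μ), ContDiff ℝ ∞ η → HasCompactSupport η → tsupport η ⊆ Ioo 0 T →
    ∫ z, u z * (deriv η z.1 * ψ z.2) ∂(spaceTime T μ)
      = -∫ z, v z * (η z.1 * ψ z.2) ∂(spaceTime T μ)

/-- `w = A u` with `A` acting on the space variable: `u(t, ·) ∈ dom A` and
`A (u(t, ·)) = w(t, ·)` for a.e. `t ∈ [0, T]`. -/
def HasSpaceOp (A : Lp ℝ 2 μ →ₗ.[ℝ] Lp ℝ 2 μ) (u w : Lp ℝ 2 (spaceTime T μ)) : Prop :=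
  ∀ᵐ t ∂((volume : Measure ℝ).restrict (Icc 0 T)),
    ∃ hu : slice u t ∈ A.domain, A ⟨slice u t, hu⟩ = slice w t

/-- The norm `‖u‖ + ℰ_T(u)^{1/2} + ‖∂ₜ u‖`, infinite if `∂ₜ u` does not exist in `L²(λ ⊗ μ)` or
`ℰ_T(u) = ∞`. The infimum is over at most one `v`. -/
def norm12 (A : Lp ℝ 2 μ →ₗ.[ℝ] Lp ℝ 2 μ) (u : Lp ℝ 2 (spaceTime T μ)) : ℝ≥0∞ :=
  ‖u‖ₑ + timeEnergy A u ^ (1 / 2 : ℝ)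
    + ⨅ (v : Lp ℝ 2 (spaceTime T μ)) (_ : HasTimeDeriv u v), ‖v‖ₑ

/-- The norm `‖u‖ + ℰ_T(u)^{1/2} + ‖A u‖ + ‖∂ₜ u‖ + ℰ_T(∂ₜ u)^{1/2} + ‖∂ₜₜ u‖`, infinite if one
of the terms does not exist. The infima are over at most one element. -/
def norm22 (A : Lp ℝ 2 μ →ₗ.[ℝ] Lp ℝ 2 μ) (u : Lp ℝ 2 (spaceTime T μ)) : ℝ≥0∞ :=
  ‖u‖ₑ + timeEnergy A u ^ (1 / 2 : ℝ)
    + (⨅ (w : Lp ℝ 2 (spaceTime T μ)) (_ : HasSpaceOp A u w), ‖w‖ₑ)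
    + ⨅ (v : Lp ℝ 2 (spaceTime T μ)) (_ : HasTimeDeriv u v),
        (‖v‖ₑ + timeEnergy A v ^ (1 / 2 : ℝ)
          + ⨅ (w : Lp ℝ 2 (spaceTime T μ)) (_ : HasTimeDeriv v w), ‖w‖ₑ)

end SpaceTime

/-! ### Smooth functions and Sobolev spaces with Dirichlet conditions in time -/

section Sobolev

variable {d : ℕ} {μ : Measure (EuclideanSpace ℝ (Fin d))} {T : ℝ}

/-- `C^∞(S) ∩ dom A` is a core of `A`, i.e. dense in `dom A` for the graph norm. -/
def SmoothCore (S : Set (EuclideanSpace ℝ (Fin d))) (A : Lp ℝ 2 μ →ₗ.[ℝ] Lp ℝ 2 μ) : Prop :=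
  ∀ (f : A.domain) (ε : ℝ), 0 < ε → ∃ φ : A.domain,
    (∃ r : EuclideanSpace ℝ (Fin d) → ℝ, ContDiffOn ℝ ∞ r S ∧ ⇑(φ : Lp ℝ 2 μ) =ᵐ[μ] r) ∧
    ‖(φ : Lp ℝ 2 μ) - f‖ < ε ∧ ‖A φ - A f‖ < ε

/-- The elements of `L²(λ ⊗ μ)` given by a function in `C^∞([0, T] × S)` that vanishes on
`{0, T} × S`. -/
def IsSmoothDirichlet (S : Set (EuclideanSpace ℝ (Fin d))) (u : Lp ℝ 2 (spaceTime T μ)) : Prop :=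
  ∃ r : ℝ × EuclideanSpace ℝ (Fin d) → ℝ,
    ContDiffOn ℝ ∞ r (Icc 0 T ×ˢ S) ∧ (∀ x ∈ S, r (0, x) = 0 ∧ r (T, x) = 0) ∧
    ⇑u =ᵐ[spaceTime T μ] r

/-- `H^{1,2}_D(λ ⊗ μ)`: the closure, with respect to `norm12`, of the smooth functions on
`[0, T] × S` of finite norm that vanish at times `0` and `T`. -/
def sobolev12 (S : Set (EuclideanSpace ℝ (Fin d))) (A : Lp ℝ 2 μ →ₗ.[ℝ] Lp ℝ 2 μ) :
    Set (Lp ℝ 2 (spaceTime T μ)) :=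
  {u | norm12 A u < ⊤ ∧ ∃ φ : ℕ → Lp ℝ 2 (spaceTime T μ),
    (∀ n, IsSmoothDirichlet S (φ n) ∧ norm12 A (φ n) < ⊤) ∧
    Tendsto (fun n => norm12 A (φ n - u)) atTop (𝓝 0)}

/-- `H^{2,2}_D(λ ⊗ μ)`: the closure, with respect to `norm22`, of the smooth functions on
`[0, T] × S` of finite norm that vanish at times `0` and `T`. -/
def sobolev22 (S : Set (EuclideanSpace ℝ (Fin d))) (A : Lp ℝ 2 μ →ₗ.[ℝ] Lp ℝ 2 μ) :
    Set (Lp ℝ 2 (spaceTime T μ)) :=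
  {u | norm22 A u < ⊤ ∧ ∃ φ : ℕ → Lp ℝ 2 (spaceTime T μ),
    (∀ n, IsSmoothDirichlet S (φ n) ∧ norm22 A (φ n) < ⊤) ∧
    Tendsto (fun n => norm22 A (φ n - u)) atTop (𝓝 0)}

end Sobolev

end DivLemma

end

/-!
The equation is solved separately on each eigenspace of the generator `L`, with bounds that do not
depend on the eigenvalue.

*Diagonalization.* Since the Poincaré inequality excludes positive eigenvalues and the spectrum is
discrete, `1` lies in the resolvent set of `L`. The resolvent `(1 - L)⁻¹` is bounded, symmetric and
injective, and its spectrum has no accumulation point except possibly `0`. Such an operator has a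
total family of eigenvectors (`orthogonal_iSup_eigenspace_eq_bot`). The elementary reason is that a
symmetric operator for which `0` is an isolated point of the spectrum is bounded below on the
orthogonal complement of its kernel. This gives an orthonormal basis `e i` with
`L (e i) = -lam i • e i` (`exists_eigenBasis`). By the Poincaré inequality, either `lam i = 0` and
`e i` is constant, or `lam i ≥ m` (`basis_eq_const`, `lam_eq_zero_or_le`).

*A single mode.* For a function `f` of time only, divide `[0, T]` into `N` cells of length
`ℓ = T / N`, and let `J f` be the sum over the cells of the mean of `f` times a smooth bump of mean
one that is supported in the interior of the cell. Then `f - J f` has mean zero on every cell, so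
its primitive `S f` vanishes at the end points of all cells, and `‖S f‖ ≤ ℓ ‖f - J f‖` by the
Cauchy-Schwarz inequality on the cells (`norm_primitiveL_le`). Each time derivative of `J f` costs a
factor `1 / ℓ`. On the mode with eigenvalue `lam`, the functions `h = S f` and
`g = (2 lam)⁻¹ J f` satisfy `∂ₜ h - 2 L g = (f - J f) + J f = f`. The choice
`N = ⌊√lam T⌋ + 1` makes `ℓ` comparable to `min (1 / √lam, T)`, so that `√lam ‖h‖` is bounded by a
multiple of `‖f‖`, and `√lam ‖∂ₜ g‖` by a multiple of `lam^(-1/2) / ℓ ≤ 1 + T⁻¹ m^(-1/2)` times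
`‖f‖`. If `lam = 0`, there is only one cell. Then `J f = 0` because `f` has mean zero, and `g = 0`
is admissible (`exists_modeSolver`).

*Summation over the modes.* `L²(λ ⊗ μ)` is the Hilbert sum of the modes `φ ⊗ e i`, and uniformly
bounded operators on the modes define bounded diagonal operators (`exists_diagonal`). The energies
are controlled through `ℰ_T(u) ≤ ‖√(-L) u‖²` (`timeEnergy_le`). In order to see that `h` and `g` lie
in the Sobolev spaces, collect a function together with its relevant derivatives in a tuple. The
closure of the space of tuples that arise from smooth functions vanishing at times `0` and `T`
(`closedGraph12`, `closedGraph22`) contains the tuples of all solutions as soon as it contains those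
of the single modes. There, `e i` is approximated by smooth functions in the graph norm of `L`,
and `√(-L)` is continuous for the graph norm.
-/

noncomputable section

namespace DivLemma

/-! ### Symmetric operators with isolated spectrum -/

section BoundedOperators

variable {H : Type*} [NormedAddCommGroup H] [InnerProductSpace ℝ H]

local notation "⟪" x ", " y "⟫" => inner ℝ x y

theorem exists_bound_of_isUnit {B : H →L[ℝ] H} (hB : IsUnit B) :
    ∃ c : ℝ, 0 < c ∧ ∀ x, c * ‖x‖ ≤ ‖B x‖ := by
  obtain ⟨u, rfl⟩ := hB
  have key : ∀ x, ‖x‖ ≤ (‖(↑u⁻¹ : H →L[ℝ] H)‖ + 1) * ‖(u : H →L[ℝ] H) x‖ := by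
    intro x
    have h1 : (↑u⁻¹ : H →L[ℝ] H) ((u : H →L[ℝ] H) x) = x := by
      rw [← mul_apply_eq_comp, Units.inv_mul, one_apply_eq_self]
    calc ‖x‖ = ‖(↑u⁻¹ : H →L[ℝ] H) ((u : H →L[ℝ] H) x)‖ := by rw [h1]
      _ ≤ ‖(↑u⁻¹ : H →L[ℝ] H)‖ * ‖(u : H →L[ℝ] H) x‖ := ContinuousLinearMap.le_opNorm _ _
      _ ≤ _ := by gcongr; linarith
  have hpos : 0 < ‖(↑u⁻¹ : H →L[ℝ] H)‖ + 1 := by positivity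
  refine ⟨(‖(↑u⁻¹ : H →L[ℝ] H)‖ + 1)⁻¹, by positivity, fun x => ?_⟩
  rw [inv_mul_le_iff₀ hpos]
  exact key x

/-- The norm of a symmetric operator is bounded by its spectral radius: it suffices that
`w - K` is bounded below for `|w| > r`. Otherwise `M² - K² = (M - K) (M + K)` would be bounded
below for `M = ‖K‖`, which fails on vectors that almost attain the norm of `K`. -/
theorem norm_apply_le_of_bounded_below {K : H →L[ℝ] H} (hK : ∀ x y, ⟪K x, y⟫ = ⟪x, K y⟫) {r : ℝ}
    (hr : 0 ≤ r)
    (h : ∀ w : ℝ, r < |w| → ∃ c : ℝ, 0 < c ∧ ∀ x, c * ‖x‖ ≤ ‖w • x - K x‖) (x : H) :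
    ‖K x‖ ≤ r * ‖x‖ := by
  suffices hM : ‖K‖ ≤ r from K.le_of_opNorm_le hM x
  by_contra! hM
  set M := ‖K‖ with hMdef
  have hM0 : 0 < M := hr.trans_lt hM
  obtain ⟨c, hc, hcx⟩ := h M (by rwa [abs_of_pos hM0])
  obtain ⟨c', hc', hcx'⟩ := h (-M) (by rwa [abs_neg, abs_of_pos hM0])
  have key : ∀ x, (c * c') ^ 2 * ‖x‖ ^ 2 ≤ M ^ 2 * (M ^ 2 * ‖x‖ ^ 2 - ‖K x‖ ^ 2) := by
    intro x
    have h1 : c * c' * ‖x‖ ≤ ‖(M ^ 2) • x - K (K x)‖ := by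
      have e1 := hcx ((-M) • x - K x)
      have e2 : M • ((-M) • x - K x) - K ((-M) • x - K x) = -((M ^ 2) • x - K (K x)) := by
        simp only [map_sub, map_smul]
        module
      rw [e2, norm_neg] at e1
      calc c * c' * ‖x‖ = c * (c' * ‖x‖) := by ring
        _ ≤ c * ‖(-M) • x - K x‖ := by gcongr; exact hcx' x
        _ ≤ _ := e1
    have h2 : ‖(M ^ 2) • x - K (K x)‖ ^ 2
        = M ^ 4 * ‖x‖ ^ 2 - 2 * M ^ 2 * ‖K x‖ ^ 2 + ‖K (K x)‖ ^ 2 := by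
      rw [norm_sub_sq_real, norm_smul, inner_smul_left, ← hK, real_inner_self_eq_norm_sq]
      simp
      ring
    have h3 : ‖K (K x)‖ ≤ M * ‖K x‖ := K.le_opNorm _
    have h4 : ‖K (K x)‖ ^ 2 ≤ M ^ 2 * ‖K x‖ ^ 2 := by
      rw [← mul_pow]; gcongr
    have h5 : (c * c' * ‖x‖) ^ 2 ≤ ‖(M ^ 2) • x - K (K x)‖ ^ 2 := by gcongr
    nlinarith
  have hle : ‖K‖ ≤ √(M ^ 2 - (c * c') ^ 2 / M ^ 2) := by
    refine ContinuousLinearMap.opNorm_le_bound _ (Real.sqrt_nonneg _) fun x => ?_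
    have h1 := key x
    have h2 : ‖K x‖ ^ 2 ≤ (M ^ 2 - (c * c') ^ 2 / M ^ 2) * ‖x‖ ^ 2 := by
      have : (c * c') ^ 2 / M ^ 2 * ‖x‖ ^ 2 ≤ M ^ 2 * ‖x‖ ^ 2 - ‖K x‖ ^ 2 := by
        rw [div_mul_eq_mul_div, div_le_iff₀ (by positivity)]
        linarith
      linarith
    calc ‖K x‖ = √(‖K x‖ ^ 2) := (Real.sqrt_sq (norm_nonneg _)).symm
      _ ≤ √((M ^ 2 - (c * c') ^ 2 / M ^ 2) * ‖x‖ ^ 2) := Real.sqrt_le_sqrt h2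
      _ = _ := by rw [Real.sqrt_mul' _ (by positivity), Real.sqrt_sq (norm_nonneg _)]
  have hlt : √(M ^ 2 - (c * c') ^ 2 / M ^ 2) < M := by
    rw [Real.sqrt_lt' hM0]
    have : 0 < (c * c') ^ 2 / M ^ 2 := by positivity
    linarith
  exact absurd hle (not_le.2 hlt)

/-- A symmetric operator without spectrum in `(0, δ)` satisfies `B² ≥ δ B`: the inverse of
`B - δ / 2` has norm at most `2 / δ`. -/
theorem mul_inner_le_of_gap {B : H →L[ℝ] H} (hB : ∀ x y, ⟪B x, y⟫ = ⟪x, B y⟫) {δ : ℝ} (hδ : 0 < δ)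
    (h : ∀ w : ℝ, 0 < w → w < δ → IsUnit (w • (1 : H →L[ℝ] H) - B)) (x : H) :
    δ * ⟪B x, x⟫ ≤ ‖B x‖ ^ 2 := by
  obtain ⟨u, hu⟩ := h (δ / 2) (by linarith) (by linarith)
  have huB : ∀ x, (u : H →L[ℝ] H) x = (δ / 2) • x - B x := fun x => by rw [hu]; simp
  set K : H →L[ℝ] H := ↑u⁻¹ with hKdef
  have hKu : ∀ x, K ((u : H →L[ℝ] H) x) = x := fun x => by
    rw [hKdef, ← mul_apply_eq_comp, Units.inv_mul, one_apply_eq_self]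
  have huK : ∀ x, (u : H →L[ℝ] H) (K x) = x := fun x => by
    rw [hKdef, ← mul_apply_eq_comp, Units.mul_inv, one_apply_eq_self]
  have husym : ∀ x y, ⟪(u : H →L[ℝ] H) x, y⟫ = ⟪x, (u : H →L[ℝ] H) y⟫ := fun x y => by
    rw [huB, huB, inner_sub_left, inner_sub_right, inner_smul_left, inner_smul_right, hB]
    simp
  have hKsym : ∀ x y, ⟪K x, y⟫ = ⟪x, K y⟫ := fun x y => by
    conv_lhs => rw [← huK y]
    rw [← husym, huK]
  have hKn : ∀ x, ‖K x‖ ≤ (2 / δ) * ‖x‖ := by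
    refine norm_apply_le_of_bounded_below hKsym (by positivity) fun w hw => ?_
    have hw0 : w ≠ 0 := by
      rintro rfl
      rw [abs_zero] at hw
      exact absurd hw (not_lt.2 (by positivity))
    have hwi : |w⁻¹| < δ / 2 := by
      rw [abs_inv, inv_lt_comm₀ (abs_pos.2 hw0) (by positivity), inv_div]
      exact hw
    obtain ⟨hw1, hw2⟩ := abs_lt.1 hwi
    have hun : IsUnit (w • (1 : H →L[ℝ] H) - K) := by
      have e : w • (1 : H →L[ℝ] H) - K
          = K * (w • ((δ / 2 - w⁻¹) • (1 : H →L[ℝ] H) - B)) := by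
        ext x
        have e1 : w • ((δ / 2 - w⁻¹) • x - B x) = w • (u : H →L[ℝ] H) x - x := by
          rw [huB, sub_smul, smul_sub, smul_sub, smul_sub, smul_inv_smul₀ hw0]
          abel
        simp only [sub_apply, smul_apply, one_apply_eq_self, mul_apply_eq_comp, e1, map_sub,
          map_smul, hKu]
      rw [e]
      refine (Units.isUnit u⁻¹).mul ?_
      have := h (δ / 2 - w⁻¹) (by linarith) (by linarith)
      exact this.smul (Units.mk0 w hw0)
    obtain ⟨c, hc, hcx⟩ := exists_bound_of_isUnit hun
    exact ⟨c, hc, fun x => by simpa using hcx x⟩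
  have h1 := hKn ((u : H →L[ℝ] H) x)
  rw [hKu, huB] at h1
  have h2 : (δ / 2) * ‖x‖ ≤ ‖(δ / 2) • x - B x‖ := by
    rw [div_mul_eq_mul_div, le_div_iff₀ hδ] at h1
    linarith
  have h3 : ((δ / 2) * ‖x‖) ^ 2 ≤ ‖(δ / 2) • x - B x‖ ^ 2 := by gcongr
  rw [norm_sub_sq_real, norm_smul, inner_smul_left, real_inner_comm,
    Real.norm_of_nonneg (by positivity)] at h3
  simp at h3
  nlinarith

/-- If `0` is an isolated point of the spectrum of a symmetric operator `B`, then `B` is bounded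
below on its range. -/
theorem mul_norm_le_of_isolated {B : H →L[ℝ] H} (hB : ∀ x y, ⟪B x, y⟫ = ⟪x, B y⟫) {δ : ℝ}
    (hδ : 0 < δ) (h : ∀ w : ℝ, w ≠ 0 → |w| < δ → IsUnit (w • (1 : H →L[ℝ] H) - B)) (x : H) :
    δ * ‖B x‖ ≤ ‖B (B x)‖ := by
  have hgap := mul_inner_le_of_gap (B := B * B)
    (fun x y => by simp only [mul_apply_eq_comp, hB]) (pow_pos hδ 2) (fun w hw hwδ => ?_)
    x
  · simp only [mul_apply_eq_comp] at hgap
    rw [hB, real_inner_self_eq_norm_sq, ← mul_pow] at hgap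
    exact le_of_sq_le_sq hgap (norm_nonneg _)
  · have hs : 0 < √w := Real.sqrt_pos.2 hw
    have hsδ : √w < δ := (Real.sqrt_lt' hδ).2 hwδ
    have e : w • (1 : H →L[ℝ] H) - B * B
        = -((√w • (1 : H →L[ℝ] H) - B) * ((-√w) • (1 : H →L[ℝ] H) - B)) := by
      ext x
      have : w • x = (√w * √w) • x := by rw [Real.mul_self_sqrt hw.le]
      simp only [sub_apply, smul_apply,
        one_apply_eq_self, mul_apply_eq_comp,
        neg_apply, map_sub, map_smul, this]
      module
    rw [e]
    refine ((h _ hs.ne' (by rwa [abs_of_pos hs])).mul (h _ (by linarith) ?_)).neg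
    rwa [abs_neg, abs_of_pos hs]

/-- A lower bound on the range of `B` extends to the closure of the range, which is the orthogonal
complement of the kernel. -/
theorem mul_norm_le_of_mem_ker_orthogonal [CompleteSpace H] {B : H →L[ℝ] H}
    (hB : ∀ x y, ⟪B x, y⟫ = ⟪x, B y⟫) {δ : ℝ}
    (h : ∀ x, δ * ‖B x‖ ≤ ‖B (B x)‖) {y : H} (hy : ∀ x, B x = 0 → ⟪x, y⟫ = 0) :
    δ * ‖y‖ ≤ ‖B y‖ := by
  have hmem : y ∈ closure (Set.range B) := by
    have h1 : y ∈ (LinearMap.range B.toLinearMap)ᗮᗮ := by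
      intro x hx
      refine hy x ?_
      rw [← inner_self_eq_zero (𝕜 := ℝ), hB, real_inner_comm]
      exact hx _ ⟨_, rfl⟩ |> fun h => by simpa [real_inner_comm] using h
    rw [Submodule.orthogonal_orthogonal_eq_closure] at h1
    exact h1
  have hcl : IsClosed {y | δ * ‖y‖ ≤ ‖B y‖} :=
    isClosed_le (by fun_prop) (by fun_prop)
  refine closure_minimal ?_ hcl hmem
  rintro _ ⟨x, rfl⟩
  exact h x

/-- An injective symmetric operator whose spectrum has no accumulation point off `0` has a total
family of eigenvectors: on the orthogonal complement of the eigenvectors, `w - R` is bounded below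
for every `w ≠ 0`, so that `R` vanishes there. -/
theorem orthogonal_iSup_eigenspace_eq_bot [CompleteSpace H] {R : H →L[ℝ] H}
    (hR : ∀ x y, ⟪R x, y⟫ = ⟪x, R y⟫) (hinj : ∀ x, R x = 0 → x = 0)
    (h : ∀ w₀ : ℝ, w₀ ≠ 0 → ∃ δ : ℝ, 0 < δ ∧ ∀ w, w ≠ w₀ → |w - w₀| < δ →
      IsUnit (w • (1 : H →L[ℝ] H) - R)) :
    (⨆ w : ℝ, Module.End.eigenspace (R : H →ₗ[ℝ] H) w)ᗮ = ⊥ := by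
  have hsym : (R : H →ₗ[ℝ] H).IsSymmetric := fun x y => hR x y
  set V := (⨆ w : ℝ, Module.End.eigenspace (R : H →ₗ[ℝ] H) w)ᗮ with hV
  have hinv : ∀ v ∈ V, R v ∈ V := fun v hv =>
    hsym.orthogonalComplement_iSup_eigenspaces_invariant hv
  let RV : V →L[ℝ] V := (R.comp V.subtypeL).codRestrict V fun v => hinv v v.2
  have hRV : ∀ v : V, ((RV v : V) : H) = R v := fun v => rfl
  have hzero : ∀ v : V, ‖RV v‖ ≤ 0 * ‖v‖ := by
    refine norm_apply_le_of_bounded_below (K := RV) (fun x y => hR x y) le_rfl fun w hw => ?_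
    have hw0 : w ≠ 0 := abs_pos.1 hw
    obtain ⟨δ, hδ, hun⟩ := h w hw0
    set B : H →L[ℝ] H := w • (1 : H →L[ℝ] H) - R with hBdef
    have hBx : ∀ x, B x = w • x - R x := fun x => by simp [hBdef]
    have hB : ∀ x y, ⟪B x, y⟫ = ⟪x, B y⟫ := fun x y => by
      rw [hBx, hBx, inner_sub_left, inner_sub_right, inner_smul_left, inner_smul_right, hR]
      simp
    have hiso := mul_norm_le_of_isolated hB hδ fun s hs hsδ => by
      have := (hun (w - s) (by simpa using hs) (by simpa using hsδ)).neg
      convert this using 1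
      ext x
      simp only [sub_apply, smul_apply,
        one_apply_eq_self, neg_apply, hBdef]
      module
    refine ⟨δ, hδ, fun v => ?_⟩
    have := mul_norm_le_of_mem_ker_orthogonal hB hiso (y := (v : H)) fun x hx => by
      refine v.2 x (Submodule.mem_iSup_of_mem w ?_)
      rw [Module.End.mem_eigenspace_iff]
      rw [hBx, sub_eq_zero] at hx
      exact hx.symm
    rw [hBx] at this
    exact this
  rw [eq_bot_iff]
  intro v hv
  have h1 := hzero ⟨v, hv⟩
  rw [zero_mul, norm_le_zero_iff] at h1
  exact hinj v (congrArg Subtype.val h1)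

end BoundedOperators

/-! ### Eigenbasis of an operator with purely discrete spectrum -/

section Eigenbasis

variable {H : Type*} [NormedAddCommGroup H] [InnerProductSpace ℝ H]

local notation "⟪" x ", " y "⟫" => inner ℝ x y

/-- An orthonormal basis of eigenvectors of a nonpositive self-adjoint operator `A`, with
eigenvalues `-lam i`. Self-adjointness enters as the last field: `A` has the maximal domain on
which multiplication of the `i`-th coefficient by `-lam i` is possible. -/
structure EigenBasis (A : H →ₗ.[ℝ] H) (ι : Type*) where
  basis : HilbertBasis ι ℝ H
  lam : ι → ℝ
  lam_nonneg : ∀ i, 0 ≤ lam i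
  inner_apply : ∀ (i : ι) (u : A.domain), ⟪basis i, A u⟫ = -lam i * ⟪basis i, (u : H)⟫
  mem_domain : ∀ u w : H, (∀ i, ⟪basis i, w⟫ = -lam i * ⟪basis i, u⟫) →
    ∃ hu : u ∈ A.domain, A ⟨u, hu⟩ = w

/-- A symmetric operator with nonnegative form and purely discrete spectrum has an eigenbasis, whose
elements are the eigenvectors of the resolvent `R = (1 - A)⁻¹`. -/
theorem exists_eigenBasis {H : Type} [NormedAddCommGroup H] [InnerProductSpace ℝ H]
    [CompleteSpace H] {A : H →ₗ.[ℝ] H}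
    (hsym : ∀ u v : A.domain, ⟪A u, (v : H)⟫ = ⟪(u : H), A v⟫)
    (hnonneg : ∀ u : A.domain, 0 ≤ preForm A u)
    (hdisc : HasPurelyDiscreteSpectrum A) :
    ∃ ι : Type, Nonempty (EigenBasis A ι) := by
  -- A positive eigenvalue is excluded by the sign of the form, hence `1` is a resolvent point.
  have hres : IsResolventPoint A 1 := by
    by_contra hcon
    obtain ⟨u, hu, hu0⟩ := (Submodule.ne_bot_iff _).1 (hdisc 1 hcon).2.1
    have hAu : A u = (1 : ℝ) • (u : H) := by
      have := LinearMap.mem_ker.1 hu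
      simpa [sub_eq_zero] using this
    have h1 := hnonneg u
    rw [preForm, hAu, one_smul, real_inner_self_eq_norm_sq] at h1
    have : (u : H) = 0 := by
      rw [← norm_eq_zero]; nlinarith [norm_nonneg (u : H)]
    exact hu0 (Subtype.ext this)
  obtain ⟨R, hR1, hR2⟩ := hres
  simp only [one_smul] at hR1 hR2
  have hRdom : ∀ x y, R x = y → ∃ hy : y ∈ A.domain, y - A ⟨y, hy⟩ = x := by
    rintro x _ rfl
    exact hR1 x
  have hRsym : ∀ x y, ⟪R x, y⟫ = ⟪x, R y⟫ := by
    intro x y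
    obtain ⟨hx, hx'⟩ := hR1 x
    obtain ⟨hy, hy'⟩ := hR1 y
    conv_lhs => rw [← hy']
    conv_rhs => rw [← hx']
    rw [inner_sub_left, inner_sub_right, ← hsym ⟨R x, hx⟩ ⟨R y, hy⟩]
  have hRinj : ∀ x, R x = 0 → x = 0 := by
    intro x hx
    obtain ⟨hx1, hx'⟩ := hR1 x
    have : (⟨R x, hx1⟩ : A.domain) = 0 := Subtype.ext hx
    rw [this, hx] at hx'
    simpa using hx'.symm
  -- `w - R` is invertible when `1 - 1 / w` is a resolvent point of `A`.
  have hunit : ∀ w : ℝ, w ≠ 0 → IsResolventPoint A (1 - w⁻¹) →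
      IsUnit (w • (1 : H →L[ℝ] H) - R) := by
    rintro w hw ⟨Z, hZ1, hZ2⟩
    let Y : H →L[ℝ] H := w⁻¹ • (1 + w⁻¹ • Z)
    have key : ∀ x, (w • (1 : H →L[ℝ] H) - R) (Y x) = x := by
      intro x
      obtain ⟨hx, hx'⟩ := hZ1 x
      have h1 : x + w⁻¹ • Z x = Z x - A ⟨Z x, hx⟩ := by
        have h0 : (1 - w⁻¹) • Z x - A ⟨Z x, hx⟩ + w⁻¹ • Z x = Z x - A ⟨Z x, hx⟩ := by module
        rwa [hx'] at h0
      have h2 : R (x + w⁻¹ • Z x) = Z x := by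
        rw [h1]
        exact hR2 ⟨Z x, hx⟩
      have h3 : Y x = w⁻¹ • (x + w⁻¹ • Z x) := by simp [Y]
      rw [h3]
      simp only [sub_apply, smul_apply,
        one_apply_eq_self, map_smul, h2]
      rw [smul_add, smul_inv_smul₀ hw, add_sub_cancel_right, inv_smul_smul₀ hw]
    have key2 : ∀ x, Y ((w • (1 : H →L[ℝ] H) - R) x) = x := by
      intro x
      obtain ⟨hx, hx'⟩ := hR1 x
      have h1 : (w • (1 : H →L[ℝ] H) - R) x
          = w • ((1 - w⁻¹) • R x - A ⟨R x, hx⟩) := by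
        simp only [sub_apply, smul_apply,
          one_apply_eq_self]
        conv_lhs => rw [← hx']
        rw [sub_smul, smul_sub, smul_sub, smul_sub, smul_inv_smul₀ hw, one_smul, hx']
        abel
      have h2 : Z ((w • (1 : H →L[ℝ] H) - R) x) = w • R x := by
        rw [h1, map_smul]
        rw [hZ2 ⟨R x, hx⟩]
      have h3 : ∀ z, Y z = w⁻¹ • (z + w⁻¹ • Z z) := by simp [Y]
      rw [h3, h2, inv_smul_smul₀ hw]
      simp [inv_smul_smul₀ hw]
    exact ⟨⟨w • (1 : H →L[ℝ] H) - R, Y, ContinuousLinearMap.ext key, ContinuousLinearMap.ext key2⟩,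
      rfl⟩
  have hbot := orthogonal_iSup_eigenspace_eq_bot hRsym hRinj fun w₀ hw₀ => by
    by_cases hz : IsResolventPoint A (1 - w₀⁻¹)
    · have h1 : w₀ ∈ resolventSet ℝ R := by
        rw [spectrum.mem_resolventSet_iff, Algebra.algebraMap_eq_smul_one]
        exact hunit w₀ hw₀ hz
      obtain ⟨δ, hδ, hball⟩ := Metric.isOpen_iff.1 (spectrum.isOpen_resolventSet (𝕜 := ℝ) R) w₀ h1
      refine ⟨δ, hδ, fun w _ hw => ?_⟩
      have := hball (Metric.mem_ball.2 (by rwa [Real.dist_eq]))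
      rwa [spectrum.mem_resolventSet_iff, Algebra.algebraMap_eq_smul_one] at this
    · obtain ⟨⟨ε, hε, hiso⟩, -⟩ := hdisc _ hz
      have hcont : ContinuousAt (fun w : ℝ => 1 - w⁻¹) w₀ :=
        continuousAt_const.sub (continuousAt_inv₀ hw₀)
      have hev : ∀ᶠ w in 𝓝 w₀, |(1 - w⁻¹) - (1 - w₀⁻¹)| < ε ∧ w ≠ 0 := by
        refine (Metric.tendsto_nhds.1 hcont ε hε).and (eventually_ne_nhds hw₀)
      obtain ⟨δ, hδ, hball⟩ := Metric.eventually_nhds_iff.1 hev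
      refine ⟨δ, hδ, fun w hne hw => ?_⟩
      obtain ⟨h1, h2⟩ := hball (by rwa [Real.dist_eq])
      refine hunit w h2 ?_
      by_contra hcon
      have := hiso _ hcon h1
      exact hne (inv_injective (by linarith))
  -- Orthonormal bases of the eigenspaces of `R` combine to one of `H`.
  have hRS : (R : H →ₗ[ℝ] H).IsSymmetric := fun x y => hRsym x y
  have hb : ∀ w : ℝ, ∃ (s : Set (Module.End.eigenspace (R : H →ₗ[ℝ] H) w))
      (b : HilbertBasis s ℝ (Module.End.eigenspace (R : H →ₗ[ℝ] H) w)), ⇑b = ((↑) : s → _) := by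
    intro w
    have hcl : IsClosed (Module.End.eigenspace (R : H →ₗ[ℝ] H) w : Set H) := by
      have : (Module.End.eigenspace (R : H →ₗ[ℝ] H) w : Set H) = {x | R x = w • x} := by
        ext x; simp
      rw [this]
      exact isClosed_eq R.continuous (by fun_prop)
    have : CompleteSpace (Module.End.eigenspace (R : H →ₗ[ℝ] H) w) := hcl.completeSpace_coe
    exact exists_hilbertBasis ℝ _
  choose s b hbs using hb
  have hon : Orthonormal ℝ fun a : (Σ w : ℝ, s w) => ((b a.1 a.2 : _) : H) :=
    hRS.orthogonalFamily_eigenspaces.orthonormal_sigma_orthonormal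
      (v_family := fun w => ⇑(b w)) fun w => (b w).orthonormal
  have htot : (Submodule.span ℝ (Set.range fun a : (Σ w : ℝ, s w) => ((b a.1 a.2 : _) : H)))ᗮ
      = ⊥ := by
    rw [eq_bot_iff, ← hbot]
    intro x hx
    rw [← Submodule.iInf_orthogonal, Submodule.mem_iInf]
    intro w
    have hsub : (Module.End.eigenspace (R : H →ₗ[ℝ] H) w : Set H) ⊆ {y | ⟪y, x⟫ = 0} := by
      intro y hy
      have hy' : (⟨y, hy⟩ : Module.End.eigenspace (R : H →ₗ[ℝ] H) w)
          ∈ (Submodule.span ℝ (Set.range (b w))).topologicalClosure := by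
        rw [(b w).dense_span]; trivial
      have hclosed : IsClosed {z : Module.End.eigenspace (R : H →ₗ[ℝ] H) w | ⟪(z : H), x⟫ = 0} :=
        isClosed_eq (by fun_prop) continuous_const
      refine closure_minimal ?_ hclosed hy'
      intro z hz
      induction hz using Submodule.span_induction with
      | mem z hz =>
        obtain ⟨k, rfl⟩ := hz
        exact hx _ (Submodule.subset_span ⟨⟨w, k⟩, rfl⟩)
      | zero => simp
      | add y z _ _ h1 h2 =>
        simp only [Set.mem_ofPred_eq, Submodule.coe_add, inner_add_left] at *
        rw [h1, h2, add_zero]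
      | smul c y _ h1 =>
        simp only [Set.mem_ofPred_eq, Submodule.coe_smul, inner_smul_left] at *
        rw [h1, mul_zero]
    exact fun y hy => hsub hy
  let e := HilbertBasis.mkOfOrthogonalEqBot hon htot
  have he : ∀ a, e a = ((b a.1 a.2 : _) : H) := fun a => by
    simp [e, HilbertBasis.coe_mkOfOrthogonalEqBot]
  have hRe : ∀ a, R (e a) = a.1 • e a := fun a => by
    rw [he]
    exact Module.End.mem_eigenspace_iff.1 (b a.1 a.2).2
  have hene : ∀ a, e a ≠ 0 := fun a => e.orthonormal.ne_zero a
  have hwne : ∀ a : (Σ w : ℝ, s w), a.1 ≠ 0 := fun a h0 => by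
    have := hRe a
    rw [h0, zero_smul] at this
    exact hene a (hRinj _ this)
  have hAe : ∀ a, ∃ h : e a ∈ A.domain, A ⟨e a, h⟩ = (-(a.1⁻¹ - 1)) • e a := by
    intro a
    have h3 : R (a.1⁻¹ • e a) = e a := by rw [map_smul, hRe, inv_smul_smul₀ (hwne a)]
    obtain ⟨h1, h2⟩ := hRdom _ _ h3
    refine ⟨h1, ?_⟩
    rw [sub_eq_iff_eq_add, add_comm, ← sub_eq_iff_eq_add] at h2
    rw [← h2]
    module
  have hin : ∀ a (u : A.domain), ⟪e a, A u⟫ = -(a.1⁻¹ - 1) * ⟪e a, (u : H)⟫ := by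
    intro a u
    obtain ⟨h1, h2⟩ := hAe a
    rw [← hsym ⟨e a, h1⟩ u, h2, inner_smul_left]
    simp
  refine ⟨_, ⟨e, fun a => a.1⁻¹ - 1, fun a => ?_, hin, fun u w huw => ?_⟩⟩
  · obtain ⟨h1, h2⟩ := hAe a
    have h3 := hnonneg ⟨e a, h1⟩
    rw [preForm, h2, inner_smul_right, real_inner_self_eq_norm_sq, e.orthonormal.1 a] at h3
    linarith
  · -- The element `R (u - w)` of the domain has the coefficients of `u`.
    have hu : R (u - w) = u := by
      refine e.repr.injective (lp.ext (funext fun a => ?_))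
      rw [e.repr_apply_apply, e.repr_apply_apply, ← hRsym, hRe, inner_smul_left, inner_sub_right,
        huw a]
      have := hwne a
      simp only [conj_trivial]
      field_simp
      ring
    obtain ⟨h1, h2⟩ := hRdom _ _ hu
    exact ⟨h1, sub_right_injective h2⟩

end Eigenbasis

/-! ### Local averaging on `L²(0, T)` -/

section LpInner

variable {Ω : Type*} [MeasurableSpace Ω] {ν : Measure Ω}

theorem inner_eq_integral_mul (u v : Lp ℝ 2 ν) : inner ℝ u v = ∫ z, u z * v z ∂ν := by
  rw [L2.inner_def]
  exact integral_congr_ae (Eventually.of_forall fun z => by simp [mul_comm])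

theorem inner_toLp_eq_integral_mul {u v : Ω → ℝ} (hu : MemLp u 2 ν) (hv : MemLp v 2 ν) :
    inner ℝ (hu.toLp u) (hv.toLp v) = ∫ z, u z * v z ∂ν := by
  rw [inner_eq_integral_mul]
  refine integral_congr_ae ?_
  filter_upwards [hu.coeFn_toLp, hv.coeFn_toLp] with z h1 h2
  rw [h1, h2]

theorem norm_sq_eq_integral_sq (u : Lp ℝ 2 ν) : ‖u‖ ^ 2 = ∫ z, u z ^ 2 ∂ν := by
  rw [← real_inner_self_eq_norm_sq, inner_eq_integral_mul]
  simp only [sq]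

theorem norm_toLp_sq_eq_integral_sq {u : Ω → ℝ} (hu : MemLp u 2 ν) :
    ‖hu.toLp u‖ ^ 2 = ∫ z, u z ^ 2 ∂ν := by
  rw [← real_inner_self_eq_norm_sq, inner_toLp_eq_integral_mul]
  simp only [sq]

end LpInner

section OrthogonalSums

variable {E : Type*} [NormedAddCommGroup E] [InnerProductSpace ℝ E]

theorem norm_sum_smul_sq {ι : Type*} (s : Finset ι) {b : ι → E}
    (hb : ∀ i j, i ≠ j → inner ℝ (b i) (b j) = 0) (x : ι → ℝ) :
    ‖∑ i ∈ s, x i • b i‖ ^ 2 = ∑ i ∈ s, x i ^ 2 * ‖b i‖ ^ 2 := by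
  classical
  rw [← real_inner_self_eq_norm_sq, sum_inner]
  refine Finset.sum_congr rfl fun i hi => ?_
  rw [inner_sum, Finset.sum_eq_single i]
  · rw [inner_smul_left, inner_smul_right, real_inner_self_eq_norm_sq]
    simp
    ring
  · intro j _ hj
    rw [inner_smul_left, inner_smul_right, hb i j hj.symm]
    simp
  · exact fun h => absurd hi h

/-- The operator that maps one orthogonal family to another one is bounded. -/
theorem norm_sum_inner_smul_sq_le {ι : Type*} (s : Finset ι) {a b : ι → E}
    (ha : ∀ i j, i ≠ j → inner ℝ (a i) (a j) = 0) (hb : ∀ i j, i ≠ j → inner ℝ (b i) (b j) = 0)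
    {α β : ℝ} (hα : 0 ≤ α) (hβ : 0 ≤ β) (hna : ∀ i, ‖a i‖ ^ 2 ≤ α) (hnb : ∀ i, ‖b i‖ ^ 2 ≤ β)
    (f : E) :
    ‖∑ i ∈ s, (inner ℝ (a i) f : ℝ) • b i‖ ^ 2 ≤ α * β * ‖f‖ ^ 2 := by
  set σ := ∑ i ∈ s, (inner ℝ (a i) f : ℝ) ^ 2 with hσ
  have hσ0 : 0 ≤ σ := Finset.sum_nonneg fun i _ => sq_nonneg _
  have hbessel : σ ≤ α * ‖f‖ ^ 2 := by
    have h1 : σ = inner ℝ (∑ i ∈ s, (inner ℝ (a i) f : ℝ) • a i) f := by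
      rw [sum_inner]
      refine Finset.sum_congr rfl fun i _ => ?_
      rw [inner_smul_left]
      simp [sq]
    have h2 : ‖∑ i ∈ s, (inner ℝ (a i) f : ℝ) • a i‖ ^ 2 ≤ α * σ := by
      rw [norm_sum_smul_sq s ha, hσ, Finset.mul_sum]
      refine Finset.sum_le_sum fun i _ => ?_
      rw [mul_comm]
      gcongr
      exact hna i
    have h3 := real_inner_le_norm (∑ i ∈ s, (inner ℝ (a i) f : ℝ) • a i) f
    rw [← h1] at h3
    have h4 : σ ^ 2 ≤ (α * σ) * ‖f‖ ^ 2 := by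
      calc σ ^ 2 ≤ (‖∑ i ∈ s, (inner ℝ (a i) f : ℝ) • a i‖ * ‖f‖) ^ 2 := by gcongr
        _ ≤ _ := by rw [mul_pow]; gcongr
    rcases hσ0.eq_or_lt with h0 | h0
    · rw [← h0]; positivity
    · nlinarith
  rw [norm_sum_smul_sq s hb]
  calc ∑ i ∈ s, (inner ℝ (a i) f : ℝ) ^ 2 * ‖b i‖ ^ 2
      ≤ ∑ i ∈ s, (inner ℝ (a i) f : ℝ) ^ 2 * β := by
        refine Finset.sum_le_sum fun i _ => ?_
        gcongr
        exact hnb i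
    _ = σ * β := by rw [Finset.sum_mul]
    _ ≤ α * ‖f‖ ^ 2 * β := by gcongr
    _ = _ := by ring

end OrthogonalSums

/-- `L²(0, T)`. -/
abbrev TimeL2 (T : ℝ) : Type := Lp ℝ 2 ((volume : Measure ℝ).restrict (Icc 0 T))

/-- A bounded measurable function that vanishes off the unit interval `(0, 1)`. -/
structure Profile where
  fn : ℝ → ℝ
  bound : ℝ
  measurable : Measurable fn
  abs_le : ∀ s, |fn s| ≤ bound
  eq_zero : ∀ s, s ∉ Ioo (0 : ℝ) 1 → fn s = 0

namespace Profile

theorem bound_nonneg (p : Profile) : 0 ≤ p.bound := (abs_nonneg _).trans (p.abs_le 0)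

theorem memLp_cell (p : Profile) (T ℓ : ℝ) (j : ℕ) :
    MemLp (fun t => p.fn (t / ℓ - j)) 2 ((volume : Measure ℝ).restrict (Icc 0 T)) :=
  MemLp.of_bound (p.measurable.comp (by fun_prop)).aestronglyMeasurable p.bound
    (Eventually.of_forall fun t => p.abs_le _)

/-- The profile `p` transported to the cell `(j ℓ, (j + 1) ℓ)`. -/
def cell (p : Profile) (T ℓ : ℝ) (j : ℕ) : TimeL2 T := (p.memLp_cell T ℓ j).toLp

theorem coeFn_cell (p : Profile) (T ℓ : ℝ) (j : ℕ) :
    p.cell T ℓ j =ᵐ[(volume : Measure ℝ).restrict (Icc 0 T)] fun t => p.fn (t / ℓ - j) :=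
  MemLp.coeFn_toLp _

/-- The indicator function of the unit interval. -/
def unit : Profile where
  fn := (Ioo (0 : ℝ) 1).indicator 1
  bound := 1
  measurable := measurable_one.indicator measurableSet_Ioo
  abs_le s := by by_cases h : s ∈ Ioo (0 : ℝ) 1 <;> simp [h]
  eq_zero s hs := by simp [hs]

theorem fn_mul_fn_eq_zero (p q : Profile) (s : ℝ) {i j : ℕ} (hij : i ≠ j) :
    p.fn (s - i) * q.fn (s - j) = 0 := by
  by_contra h
  have h1 : s - i ∈ Ioo (0 : ℝ) 1 := by
    by_contra h'
    exact h (by rw [p.eq_zero _ h', zero_mul])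
  have h2 : s - j ∈ Ioo (0 : ℝ) 1 := by
    by_contra h'
    exact h (by rw [q.eq_zero _ h', mul_zero])
  obtain ⟨a1, a2⟩ := h1
  obtain ⟨b1, b2⟩ := h2
  have c1 : (i : ℝ) < j + 1 := by linarith
  have c2 : (j : ℝ) < i + 1 := by linarith
  norm_cast at c1 c2
  omega

theorem inner_cell_of_ne (p q : Profile) (T ℓ : ℝ) {i j : ℕ} (hij : i ≠ j) :
    inner ℝ (p.cell T ℓ i) (q.cell T ℓ j) = 0 := by
  rw [cell, cell, inner_toLp_eq_integral_mul]
  simp [p.fn_mul_fn_eq_zero q _ hij]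

theorem norm_cell_sq_le (p : Profile) (T : ℝ) {ℓ : ℝ} (hℓ : 0 < ℓ) (j : ℕ) :
    ‖p.cell T ℓ j‖ ^ 2 ≤ p.bound ^ 2 * ℓ := by
  rw [cell, norm_toLp_sq_eq_integral_sq]
  set I := Icc ((j : ℝ) * ℓ) ((j + 1) * ℓ) with hI
  calc ∫ t in Icc 0 T, p.fn (t / ℓ - j) ^ 2
      ≤ ∫ t in Icc 0 T, I.indicator (fun _ => p.bound ^ 2) t := by
        refine integral_mono_of_nonneg (Eventually.of_forall fun t => sq_nonneg _)
          ((integrable_const _).indicator measurableSet_Icc) (Eventually.of_forall fun t => ?_)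
        by_cases ht : t ∈ I
        · simp only [indicator_of_mem ht]
          exact sq_le_sq.2 ((p.abs_le _).trans (le_abs_self _))
        · simp only [indicator_of_notMem ht]
          rw [p.eq_zero]
          · simp
          · rintro ⟨h1, h2⟩
            refine ht ⟨?_, ?_⟩
            · rw [sub_pos, lt_div_iff₀ hℓ] at h1
              exact h1.le
            · rw [sub_lt_iff_lt_add, div_lt_iff₀ hℓ, add_comm] at h2
              exact h2.le
    _ = p.bound ^ 2 * (volume.restrict (Icc 0 T)).real I := by
        rw [integral_indicator_const _ measurableSet_Icc, smul_eq_mul, mul_comm]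
    _ ≤ p.bound ^ 2 * (volume : Measure ℝ).real I := by
        gcongr
        exact ENNReal.toReal_mono (by simp [hI]) (Measure.restrict_apply_le _ _)
    _ = p.bound ^ 2 * ℓ := by
        rw [hI, Real.volume_real_Icc_of_le (by nlinarith)]
        ring

/-- Local averaging on `N` cells of length `ℓ`: on the `j`-th cell, `f` is replaced by its mean
over the cell times the profile `p`. -/
def average (p : Profile) (T ℓ : ℝ) (N : ℕ) : TimeL2 T →L[ℝ] TimeL2 T :=
  ℓ⁻¹ • ∑ j ∈ Finset.range N, (innerSL ℝ (unit.cell T ℓ j)).smulRight (p.cell T ℓ j)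

theorem average_apply (p : Profile) (T ℓ : ℝ) (N : ℕ) (f : TimeL2 T) :
    p.average T ℓ N f
      = ℓ⁻¹ • ∑ j ∈ Finset.range N, (inner ℝ (unit.cell T ℓ j) f : ℝ) • p.cell T ℓ j := by
  simp [average]

theorem norm_average_le (p : Profile) (T : ℝ) {ℓ : ℝ} (hℓ : 0 < ℓ) (N : ℕ) :
    ‖p.average T ℓ N‖ ≤ p.bound := by
  refine ContinuousLinearMap.opNorm_le_bound _ p.bound_nonneg fun f => ?_
  have h := norm_sum_inner_smul_sq_le (Finset.range N)
    (fun i j hij => unit.inner_cell_of_ne unit T ℓ hij)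
    (fun i j hij => p.inner_cell_of_ne p T ℓ hij) hℓ.le
    (mul_nonneg (sq_nonneg p.bound) hℓ.le)
    (fun i => by simpa [unit] using unit.norm_cell_sq_le T hℓ i)
    (fun i => p.norm_cell_sq_le T hℓ i) f
  have h2 : ‖∑ i ∈ Finset.range N, (inner ℝ (unit.cell T ℓ i) f : ℝ) • p.cell T ℓ i‖
      ≤ ℓ * (p.bound * ‖f‖) := by
    refine le_of_sq_le_sq (h.trans_eq (by ring)) ?_
    have := p.bound_nonneg
    positivity
  rw [average_apply, norm_smul, Real.norm_of_nonneg (by positivity), inv_mul_le_iff₀ hℓ]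
  exact h2

theorem average_ae_eq (p : Profile) (T ℓ : ℝ) (N : ℕ) (f : TimeL2 T) :
    p.average T ℓ N f =ᵐ[(volume : Measure ℝ).restrict (Icc 0 T)] fun t =>
      ℓ⁻¹ * ∑ j ∈ Finset.range N, (inner ℝ (unit.cell T ℓ j) f : ℝ) * p.fn (t / ℓ - j) := by
  have hsum : ∀ n : ℕ, (∑ j ∈ Finset.range n, (inner ℝ (unit.cell T ℓ j) f : ℝ) • p.cell T ℓ j :
      TimeL2 T) =ᵐ[(volume : Measure ℝ).restrict (Icc 0 T)] fun t =>
        ∑ j ∈ Finset.range n, (inner ℝ (unit.cell T ℓ j) f : ℝ) * p.fn (t / ℓ - j) := by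
    intro n
    induction n with
    | zero =>
      simp only [Finset.range_zero, Finset.sum_empty]
      exact Lp.coeFn_zero _ _ _
    | succ n ih =>
      simp only [Finset.sum_range_succ]
      filter_upwards [ih, Lp.coeFn_add
        (∑ j ∈ Finset.range n, (inner ℝ (unit.cell T ℓ j) f : ℝ) • p.cell T ℓ j)
        ((inner ℝ (unit.cell T ℓ n) f : ℝ) • p.cell T ℓ n),
        Lp.coeFn_smul (inner ℝ (unit.cell T ℓ n) f : ℝ) (p.cell T ℓ n),
        p.coeFn_cell T ℓ n] with t h1 h2 h3 h4
      rw [h2, Pi.add_apply, h1, h3, Pi.smul_apply, smul_eq_mul, h4]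
  rw [average_apply]
  filter_upwards [hsum N, Lp.coeFn_smul ℓ⁻¹
    (∑ j ∈ Finset.range N, (inner ℝ (unit.cell T ℓ j) f : ℝ) • p.cell T ℓ j)] with t h1 h2
  rw [h2, Pi.smul_apply, h1, smul_eq_mul]

/-- A profile of mean one reproduces the cell averages. -/
theorem inner_unit_cell_cell (p : Profile) (hp : ∫ s, p.fn s = 1) {T ℓ : ℝ} {N : ℕ} (hℓ : 0 < ℓ)
    (hN : N * ℓ = T) {j : ℕ} (hj : j < N) :
    inner ℝ (unit.cell T ℓ j) (p.cell T ℓ j) = ℓ := by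
  have hT : 0 ≤ T := by rw [← hN]; positivity
  rw [cell, cell, inner_toLp_eq_integral_mul]
  have h1 : ∀ s, unit.fn s * p.fn s = p.fn s := fun s => by
    by_cases hs : s ∈ Ioo (0 : ℝ) 1
    · simp [unit, hs]
    · rw [p.eq_zero s hs, mul_zero]
  simp only [h1]
  rw [integral_Icc_eq_integral_Ioc, ← intervalIntegral.integral_of_le hT,
    intervalIntegral.integral_comp_div_sub _ hℓ.ne',
    intervalIntegral.integral_eq_integral_of_support_subset, hp, smul_eq_mul, mul_one]
  intro s hs
  have hs' : s ∈ Ioo (0 : ℝ) 1 := by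
    by_contra h
    exact hs (p.eq_zero s h)
  have hj' : (j : ℝ) + 1 ≤ N := by exact_mod_cast hj
  have : T / ℓ = N := by rw [← hN]; field_simp
  rw [this]
  refine ⟨?_, by linarith [hs'.2]⟩
  have : (0 : ℝ) ≤ j := by positivity
  have := hs'.1
  rw [zero_div]
  linarith

theorem inner_unit_cell_average (p : Profile) (hp : ∫ s, p.fn s = 1) {T ℓ : ℝ} {N : ℕ}
    (hℓ : 0 < ℓ) (hN : N * ℓ = T) {j : ℕ} (hj : j < N) (f : TimeL2 T) :
    inner ℝ (unit.cell T ℓ j) (p.average T ℓ N f) = inner ℝ (unit.cell T ℓ j) f := by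
  rw [average_apply, inner_smul_right, inner_sum, Finset.sum_eq_single j]
  · rw [inner_smul_right, p.inner_unit_cell_cell hp hℓ hN hj]
    field_simp
  · intro i _ hi
    rw [inner_smul_right, unit.inner_cell_of_ne p T ℓ hi.symm, mul_zero]
  · intro h
    exact absurd (Finset.mem_range.2 hj) h

end Profile

/-! ### The primitive of a function in `L²(0, T)` -/

section Primitive

variable {T : ℝ}

theorem integrable_indicator_coe (c : TimeL2 T) : Integrable ((Icc 0 T).indicator c) := by
  rw [integrable_indicator_iff measurableSet_Icc]
  exact (Lp.memLp c).integrable (by norm_num)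

theorem integrable_indicator_coe_sq (c : TimeL2 T) :
    Integrable (fun t => (Icc 0 T).indicator c t ^ 2) := by
  have : (fun t => (Icc 0 T).indicator c t ^ 2) = (Icc 0 T).indicator fun t => c t ^ 2 := by
    ext t
    by_cases ht : t ∈ Icc 0 T <;> simp [ht]
  rw [this, integrable_indicator_iff measurableSet_Icc]
  exact (memLp_two_iff_integrable_sq (Lp.aestronglyMeasurable c)).1 (Lp.memLp c)

/-- The primitive `t ↦ ∫₀ᵗ c` for `c ∈ L²(0, T)` (extended by `0` to the line). -/
def primitive (c : TimeL2 T) (t : ℝ) : ℝ := ∫ s in (0 : ℝ)..t, (Icc 0 T).indicator c s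

theorem continuous_primitive (c : TimeL2 T) : Continuous (primitive c) :=
  intervalIntegral.continuous_primitive
    (fun _ _ => (integrable_indicator_coe c).intervalIntegrable) 0

theorem sq_intervalIntegral_le {c : ℝ → ℝ} (hc : Integrable c) (hc2 : Integrable fun t => c t ^ 2)
    {a b : ℝ} (hab : a ≤ b) : (∫ s in a..b, c s) ^ 2 ≤ (b - a) * ∫ s in a..b, c s ^ 2 := by
  rcases hab.eq_or_lt with rfl | h
  · simp
  -- Integrate the square of `c` minus its mean over `(a, b)`.
  set m := (∫ s in a..b, c s) / (b - a) with hm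
  have hba : 0 < b - a := sub_pos.2 h
  have h0 : 0 ≤ ∫ s in a..b, (c s - m) ^ 2 :=
    intervalIntegral.integral_nonneg hab fun s _ => sq_nonneg _
  have h1 : ∫ s in a..b, (c s - m) ^ 2
      = (∫ s in a..b, c s ^ 2) - 2 * m * (∫ s in a..b, c s) + m ^ 2 * (b - a) := by
    have : ∀ s, (c s - m) ^ 2 = c s ^ 2 - 2 * m * c s + m ^ 2 := fun s => by ring
    simp only [this]
    rw [intervalIntegral.integral_add, intervalIntegral.integral_sub,
      intervalIntegral.integral_const_mul, intervalIntegral.integral_const, smul_eq_mul]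
    · ring
    · exact hc2.intervalIntegrable
    · exact (hc.const_mul _).intervalIntegrable
    · exact (hc2.sub (hc.const_mul _)).intervalIntegrable
    · simp
  have h2 : (∫ s in a..b, c s) = m * (b - a) := by rw [hm]; field_simp
  rw [h1, h2] at h0
  rw [h2]
  nlinarith

theorem integral_indicator_coe_sq (c : TimeL2 T) (hT : 0 ≤ T) :
    ∫ s in (0 : ℝ)..T, (Icc 0 T).indicator c s ^ 2 = ‖c‖ ^ 2 := by
  rw [norm_sq_eq_integral_sq, integral_Icc_eq_integral_Ioc, intervalIntegral.integral_of_le hT]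
  refine setIntegral_congr_fun measurableSet_Ioc fun s hs => ?_
  simp [indicator_of_mem (Ioc_subset_Icc_self hs)]

theorem abs_primitive_le (c : TimeL2 T) {t : ℝ} (ht : t ∈ Icc 0 T) :
    |primitive c t| ≤ √T * ‖c‖ := by
  have hT : 0 ≤ T := ht.1.trans ht.2
  refine abs_le_of_sq_le_sq ?_ (by positivity)
  rw [mul_pow, Real.sq_sqrt hT, ← integral_indicator_coe_sq c hT]
  refine (sq_intervalIntegral_le (integrable_indicator_coe c) (integrable_indicator_coe_sq c)
    ht.1).trans ?_
  rw [sub_zero]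
  have h0 : ∀ a b : ℝ, a ≤ b → 0 ≤ ∫ s in a..b, (Icc 0 T).indicator c s ^ 2 :=
    fun a b hab => intervalIntegral.integral_nonneg hab fun s _ => sq_nonneg _
  have h1 := intervalIntegral.integral_add_adjacent_intervals
    ((integrable_indicator_coe_sq c).intervalIntegrable (a := 0) (b := t))
    ((integrable_indicator_coe_sq c).intervalIntegrable (b := T))
  have h2 := h0 t T ht.2
  have h3 := h0 0 t ht.1
  rw [← h1]
  calc t * _ ≤ T * ∫ s in (0 : ℝ)..t, (Icc 0 T).indicator c s ^ 2 := by
        gcongr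
        exact ht.2
    _ ≤ _ := by gcongr; linarith

theorem memLp_primitive (c : TimeL2 T) :
    MemLp (primitive c) 2 ((volume : Measure ℝ).restrict (Icc 0 T)) :=
  MemLp.of_bound (continuous_primitive c).aestronglyMeasurable (√T * ‖c‖)
    ((ae_restrict_iff' measurableSet_Icc).2 (Eventually.of_forall fun _ ht =>
      abs_primitive_le c ht))

theorem primitive_congr {c : TimeL2 T} {F : ℝ → ℝ}
    (h : c =ᵐ[(volume : Measure ℝ).restrict (Icc 0 T)] F) {t : ℝ} (ht : t ∈ Icc 0 T) :
    primitive c t = ∫ s in (0 : ℝ)..t, F s := by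
  rw [primitive, intervalIntegral.integral_of_le ht.1, intervalIntegral.integral_of_le ht.1]
  have hsub : Ioc 0 t ⊆ Icc 0 T := fun s hs => ⟨hs.1.le, hs.2.trans ht.2⟩
  refine integral_congr_ae ?_
  filter_upwards [ae_restrict_of_ae_restrict_of_subset hsub h, ae_restrict_mem measurableSet_Ioc]
    with s hs hs'
  rw [indicator_of_mem (hsub hs'), hs]

theorem primitive_add (c d : TimeL2 T) {t : ℝ} (ht : t ∈ Icc 0 T) :
    primitive (c + d) t = primitive c t + primitive d t := by
  rw [primitive_congr (F := fun s => (Icc 0 T).indicator c s + (Icc 0 T).indicator d s) _ ht,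
    intervalIntegral.integral_add (integrable_indicator_coe c).intervalIntegrable
      (integrable_indicator_coe d).intervalIntegrable]
  · rfl
  · filter_upwards [Lp.coeFn_add c d, ae_restrict_mem measurableSet_Icc] with s hs hs'
    rw [hs, indicator_of_mem hs', indicator_of_mem hs', Pi.add_apply]

theorem primitive_smul (r : ℝ) (c : TimeL2 T) {t : ℝ} (ht : t ∈ Icc 0 T) :
    primitive (r • c) t = r * primitive c t := by
  rw [primitive_congr (F := fun s => r * (Icc 0 T).indicator c s) _ ht,
    intervalIntegral.integral_const_mul]
  · rfl
  · filter_upwards [Lp.coeFn_smul r c, ae_restrict_mem measurableSet_Icc] with s hs hs'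
    simp [hs, hs']

/-- The primitive as a linear map on `L²(0, T)`. -/
def primitiveL (T : ℝ) : TimeL2 T →ₗ[ℝ] TimeL2 T where
  toFun c := (memLp_primitive c).toLp
  map_add' c d := by
    rw [← MemLp.toLp_add]
    refine MemLp.toLp_congr _ _ ?_
    filter_upwards [ae_restrict_mem measurableSet_Icc] with s hs
    exact primitive_add c d hs
  map_smul' r c := by
    rw [RingHom.id_apply, ← MemLp.toLp_const_smul]
    refine MemLp.toLp_congr _ _ ?_
    filter_upwards [ae_restrict_mem measurableSet_Icc] with s hs
    exact primitive_smul r c hs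

theorem inner_unit_cell {ℓ : ℝ} {N : ℕ} (hℓ : 0 < ℓ) (hN : N * ℓ = T) {j : ℕ} (hj : j < N)
    (c : TimeL2 T) :
    inner ℝ (Profile.unit.cell T ℓ j) c
      = ∫ s in (j * ℓ : ℝ)..((j + 1 : ℕ) * ℓ), (Icc 0 T).indicator c s := by
  have hjN : ((j + 1 : ℕ) : ℝ) ≤ N := by exact_mod_cast hj
  have hle : (j * ℓ : ℝ) ≤ (j + 1 : ℕ) * ℓ := by push_cast; nlinarith
  have hsub : Ioo (j * ℓ : ℝ) ((j + 1 : ℕ) * ℓ) ⊆ Icc 0 T := fun s hs =>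
    ⟨le_trans (by positivity) hs.1.le, hs.2.le.trans (by rw [← hN]; gcongr)⟩
  rw [inner_eq_integral_mul, intervalIntegral.integral_of_le hle, integral_Ioc_eq_integral_Ioo,
    ← integral_indicator measurableSet_Icc, ← integral_indicator measurableSet_Ioo]
  refine integral_congr_ae ?_
  have h1 := (ae_restrict_iff' measurableSet_Icc).1 (Profile.unit.coeFn_cell T ℓ j)
  filter_upwards [h1] with s hs
  by_cases h2 : s ∈ Icc 0 T
  · have h3 : s / ℓ - j ∈ Ioo (0 : ℝ) 1 ↔ s ∈ Ioo (j * ℓ : ℝ) ((j + 1 : ℕ) * ℓ) := by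
      rw [mem_Ioo, mem_Ioo, sub_pos, lt_div_iff₀ hℓ, sub_lt_iff_lt_add, div_lt_iff₀ hℓ]
      push_cast
      rw [add_comm (1 : ℝ)]
    rw [indicator_of_mem h2]
    rw [hs h2]
    by_cases h4 : s ∈ Ioo (j * ℓ : ℝ) ((j + 1 : ℕ) * ℓ)
    · rw [indicator_of_mem h4, indicator_of_mem h2]
      simp [Profile.unit, h3.2 h4]
    · rw [indicator_of_notMem h4]
      simp only [Profile.unit]
      rw [indicator_of_notMem (mt h3.1 h4), zero_mul]
  · rw [indicator_of_notMem h2, indicator_of_notMem (fun h => h2 (hsub h))]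

theorem primitive_cell_endpoint {ℓ : ℝ} {N : ℕ} (hℓ : 0 < ℓ) (hN : N * ℓ = T) {c : TimeL2 T}
    (hc : ∀ j < N, inner ℝ (Profile.unit.cell T ℓ j) c = 0) {j : ℕ} (hj : j ≤ N) :
    primitive c (j * ℓ) = 0 := by
  induction j with
  | zero => simp [primitive]
  | succ j ih =>
    have h1 := intervalIntegral.integral_add_adjacent_intervals
      ((integrable_indicator_coe c).intervalIntegrable (a := 0) (b := j * ℓ))
      ((integrable_indicator_coe c).intervalIntegrable (b := (j + 1 : ℕ) * ℓ))
    rw [primitive, ← h1, ← inner_unit_cell hℓ hN hj, hc j hj, add_zero]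
    exact ih (by omega)

/-- Poincaré inequality on the cells: if all cell averages of `c` vanish, then the primitive of `c`
vanishes at the end points of the cells, and its norm is at most `ℓ ‖c‖`. -/
theorem norm_primitiveL_le {ℓ : ℝ} {N : ℕ} (hℓ : 0 < ℓ) (hN : N * ℓ = T) {c : TimeL2 T}
    (hc : ∀ j < N, inner ℝ (Profile.unit.cell T ℓ j) c = 0) :
    ‖primitiveL T c‖ ≤ ℓ * ‖c‖ := by
  have hT : 0 ≤ T := by rw [← hN]; positivity
  refine le_of_sq_le_sq ?_ (by positivity)
  set e := (Icc 0 T).indicator c with he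
  have hi := integrable_indicator_coe c
  have hi2 := integrable_indicator_coe_sq c
  have hcont := (continuous_primitive c).pow 2
  have h1 : ‖primitiveL T c‖ ^ 2 = ∫ t in (0 : ℝ)..T, primitive c t ^ 2 := by
    change ‖(memLp_primitive c).toLp‖ ^ 2 = _
    rw [norm_toLp_sq_eq_integral_sq, integral_Icc_eq_integral_Ioc,
      intervalIntegral.integral_of_le hT]
  have h2 := intervalIntegral.sum_integral_adjacent_intervals (f := fun t => primitive c t ^ 2)
    (a := fun k : ℕ => (k : ℝ) * ℓ) (n := N) (μ := volume)
    fun k _ => hcont.intervalIntegrable _ _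
  have h3 := intervalIntegral.sum_integral_adjacent_intervals (f := fun t => e t ^ 2)
    (a := fun k : ℕ => (k : ℝ) * ℓ) (n := N) (μ := volume) fun k _ => hi2.intervalIntegrable
  simp only [Nat.cast_zero, zero_mul, hN] at h2 h3
  rw [h1, ← h2, mul_pow, ← integral_indicator_coe_sq c hT, ← h3, Finset.mul_sum]
  refine Finset.sum_le_sum fun j hj => ?_
  have hjN := Finset.mem_range.1 hj
  have hle : (j * ℓ : ℝ) ≤ (j + 1 : ℕ) * ℓ := by push_cast; nlinarith
  have hlen : ((j + 1 : ℕ) * ℓ : ℝ) - j * ℓ = ℓ := by push_cast; ring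
  set I := ∫ s in (j * ℓ : ℝ)..((j + 1 : ℕ) * ℓ), e s ^ 2 with hI
  have hpt : ∀ t ∈ Icc (j * ℓ : ℝ) ((j + 1 : ℕ) * ℓ), primitive c t ^ 2 ≤ ℓ * I := by
    intro t ht
    have a1 : primitive c t = ∫ s in (j * ℓ : ℝ)..t, e s := by
      have := intervalIntegral.integral_add_adjacent_intervals
        (hi.intervalIntegrable (a := 0) (b := j * ℓ)) (hi.intervalIntegrable (b := t))
      have h0 : ∫ s in (0 : ℝ)..(j * ℓ), e s = 0 :=
        primitive_cell_endpoint hℓ hN hc hjN.le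
      rw [primitive, ← this, h0, zero_add]
    have a2 := intervalIntegral.integral_add_adjacent_intervals
        (hi2.intervalIntegrable (a := j * ℓ) (b := t))
        (hi2.intervalIntegrable (b := (j + 1 : ℕ) * ℓ))
    have a3 : 0 ≤ ∫ s in t..((j + 1 : ℕ) * ℓ), e s ^ 2 :=
      intervalIntegral.integral_nonneg ht.2 fun s _ => sq_nonneg _
    have a4 : 0 ≤ ∫ s in (j * ℓ)..t, e s ^ 2 :=
      intervalIntegral.integral_nonneg ht.1 fun s _ => sq_nonneg _
    rw [a1]
    refine (sq_intervalIntegral_le hi hi2 ht.1).trans ?_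
    calc _ ≤ ℓ * ∫ s in (j * ℓ)..t, e s ^ 2 := by
          gcongr
          linarith [ht.2]
      _ ≤ ℓ * I := by
          gcongr
          rw [hI, ← a2]
          linarith
  calc ∫ t in (j * ℓ : ℝ)..((j + 1 : ℕ) * ℓ), primitive c t ^ 2
      ≤ ∫ t in (j * ℓ : ℝ)..((j + 1 : ℕ) * ℓ), ℓ * I :=
        intervalIntegral.integral_mono_on hle (hcont.intervalIntegrable _ _)
          (by simp) hpt
    _ = ℓ ^ 2 * I := by
        rw [intervalIntegral.integral_const, hlen, smul_eq_mul]
        ring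

end Primitive

/-! ### Solution operators for a single mode -/

theorem exists_smooth_unit_bump : ∃ ψ : ℝ → ℝ, ContDiff ℝ ∞ ψ ∧ HasCompactSupport ψ ∧
    tsupport ψ ⊆ Ioo 0 1 ∧ ∫ s, ψ s = 1 := by
  let b : ContDiffBump (1 / 2 : ℝ) := ⟨1 / 8, 1 / 4, by norm_num, by norm_num⟩
  refine ⟨b.normed volume, b.contDiff_normed, b.hasCompactSupport_normed, ?_, b.integral_normed⟩
  rw [b.tsupport_normed_eq, Real.closedBall_eq_Icc]
  intro s hs
  constructor
  · have := hs.1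
    norm_num [b] at this
    linarith
  · have := hs.2
    norm_num [b] at this
    linarith

theorem exists_profile {ψ : ℝ → ℝ} (h1 : Continuous ψ) (h2 : HasCompactSupport ψ)
    (h3 : tsupport ψ ⊆ Ioo 0 1) : ∃ p : Profile, p.fn = ψ := by
  obtain ⟨C, hC⟩ := h1.bounded_above_of_compact_support h2
  exact ⟨⟨ψ, C, h1.measurable, hC, fun s hs => image_eq_zero_of_notMem_tsupport fun h => hs (h3 h)⟩,
    rfl⟩

/-- The superposition of copies of `ψ` transported to the cells of length `ℓ`. -/
def cellSum (ψ : ℝ → ℝ) (ℓ : ℝ) (N : ℕ) (a : ℕ → ℝ) (t : ℝ) : ℝ :=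
  ℓ⁻¹ * ∑ j ∈ Finset.range N, a j * ψ (t / ℓ - j)

theorem contDiff_cellSum {ψ : ℝ → ℝ} (h : ContDiff ℝ ∞ ψ) (ℓ : ℝ) (N : ℕ) (a : ℕ → ℝ) :
    ContDiff ℝ ∞ (cellSum ψ ℓ N a) := by
  unfold cellSum
  refine contDiff_const.mul (ContDiff.sum fun j _ => contDiff_const.mul (h.comp ?_))
  fun_prop

theorem deriv_cellSum {ψ : ℝ → ℝ} (h : Differentiable ℝ ψ) (ℓ : ℝ) (N : ℕ) (a : ℕ → ℝ) :
    deriv (cellSum ψ ℓ N a) = fun t => ℓ⁻¹ * cellSum (deriv ψ) ℓ N a t := by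
  ext t
  refine HasDerivAt.deriv ?_
  unfold cellSum
  have : ℓ⁻¹ * (ℓ⁻¹ * ∑ j ∈ Finset.range N, a j * deriv ψ (t / ℓ - j))
      = ℓ⁻¹ * ∑ j ∈ Finset.range N, a j * (deriv ψ (t / ℓ - j) * (1 / ℓ)) := by
    simp only [Finset.mul_sum]
    refine Finset.sum_congr rfl fun j _ => ?_
    ring
  rw [this]
  refine HasDerivAt.const_mul _ (HasDerivAt.fun_sum (u := Finset.range N)
    (A := fun j t => a j * ψ (t / ℓ - j)) fun j _ => ?_)
  refine HasDerivAt.const_mul _ ?_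
  exact (h _).hasDerivAt.comp t (((hasDerivAt_id t).div_const ℓ).sub_const _)

/-- Operators on `L²(0, T)` that solve the divergence equation `h' = f - J f` for a single mode on
the length scale `ℓ`: `J` replaces `f` by a local average on the scale `ℓ` that vanishes at the end
points, `J₁ f` and `J₂ f` are the first two time derivatives of `J f`, and `S f = h` is a primitive
of `f - J f` vanishing at the end points. -/
structure IsLocalSolver (T ℓ c₀ c₁ c₂ : ℝ) (J J₁ J₂ S : TimeL2 T →L[ℝ] TimeL2 T) : Prop where
  norm_J : ‖J‖ ≤ c₀
  norm_J₁ : ‖J₁‖ ≤ ℓ⁻¹ * c₁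
  norm_J₂ : ‖J₂‖ ≤ ℓ⁻¹ * (ℓ⁻¹ * c₂)
  norm_S : ‖S‖ ≤ ℓ * (1 + c₀)
  exists_smooth_J : ∀ f, ∃ G : ℝ → ℝ, ContDiff ℝ ∞ G ∧ G 0 = 0 ∧ G T = 0 ∧
    J f =ᵐ[(volume : Measure ℝ).restrict (Icc 0 T)] G ∧
    J₁ f =ᵐ[(volume : Measure ℝ).restrict (Icc 0 T)] deriv G ∧
    J₂ f =ᵐ[(volume : Measure ℝ).restrict (Icc 0 T)] deriv (deriv G)
  exists_smooth_S : ∀ (f : TimeL2 T) (F : ℝ → ℝ), ContDiff ℝ ∞ F →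
    f =ᵐ[(volume : Measure ℝ).restrict (Icc 0 T)] F → ∃ G : ℝ → ℝ, ContDiff ℝ ∞ G ∧ G 0 = 0 ∧
    G T = 0 ∧ S f =ᵐ[(volume : Measure ℝ).restrict (Icc 0 T)] G ∧
    (f - J f : TimeL2 T) =ᵐ[(volume : Measure ℝ).restrict (Icc 0 T)] deriv G
  J_eq_zero : ℓ = T → ∀ f : TimeL2 T, ∫ t in Icc 0 T, f t = 0 → J f = 0

theorem exists_continuousLinearMap_comp_sub {E : Type*} [NormedAddCommGroup E] [NormedSpace ℝ E]
    (M : E →ₗ[ℝ] E) (J : E →L[ℝ] E) {C : ℝ} (hC : 0 ≤ C) (h : ∀ f, ‖M (f - J f)‖ ≤ C * ‖f‖) :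
    ∃ S : E →L[ℝ] E, (∀ f, S f = M (f - J f)) ∧ ‖S‖ ≤ C :=
  ⟨(M.comp (LinearMap.id - J.toLinearMap)).mkContinuous C h, fun _ => rfl,
    LinearMap.mkContinuous_norm_le _ hC _⟩

/-- The operators `J`, `J₁` and `J₂` are the local averages with a bump function and its first two
derivatives as profiles. -/
theorem exists_isLocalSolver {p₀ p₁ p₂ : Profile} (hψ : ContDiff ℝ ∞ p₀.fn)
    (hp₁ : p₁.fn = deriv p₀.fn) (hp₂ : p₂.fn = deriv (deriv p₀.fn)) (hint : ∫ s, p₀.fn s = 1)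
    {T ℓ : ℝ} {N : ℕ} (hℓ : 0 < ℓ) (hN : N * ℓ = T) :
    ∃ J J₁ J₂ S : TimeL2 T →L[ℝ] TimeL2 T,
      IsLocalSolver T ℓ p₀.bound p₁.bound p₂.bound J J₁ J₂ S := by
  have hψ' : ContDiff ℝ ∞ (deriv p₀.fn) := (contDiff_infty_iff_deriv.1 hψ).2
  have hT : 0 ≤ T := by rw [← hN]; positivity
  obtain ⟨J, hJ⟩ : ∃ J, J = p₀.average T ℓ N := ⟨_, rfl⟩
  have horth : ∀ f : TimeL2 T, ∀ j < N, inner ℝ (Profile.unit.cell T ℓ j) (f - J f) = 0 :=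
    fun f j hj => by
      rw [inner_sub_right, hJ, p₀.inner_unit_cell_average hint hℓ hN hj, sub_self]
  have hnJ : ‖J‖ ≤ p₀.bound := hJ ▸ p₀.norm_average_le T hℓ N
  have hS : ∀ f : TimeL2 T, ‖primitiveL T (f - J f)‖ ≤ ℓ * (1 + p₀.bound) * ‖f‖ := fun f => by
    refine (norm_primitiveL_le hℓ hN (horth f)).trans ?_
    have h1 := J.le_of_opNorm_le hnJ f
    have h2 := norm_sub_le f (J f)
    rw [mul_assoc]
    gcongr
    linarith
  have hb : 0 ≤ ℓ * (1 + p₀.bound) := mul_nonneg hℓ.le (by linarith [p₀.bound_nonneg])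
  obtain ⟨S, hSapply, hSnorm⟩ := exists_continuousLinearMap_comp_sub (primitiveL T) J hb hS
  have hvanish : ∀ (a : ℕ → ℝ), cellSum p₀.fn ℓ N a 0 = 0 ∧ cellSum p₀.fn ℓ N a T = 0 := by
    intro a
    have hTl : T / ℓ = N := by rw [← hN]; field_simp
    constructor
    · unfold cellSum
      rw [Finset.sum_eq_zero, mul_zero]
      intro j _
      rw [p₀.eq_zero, mul_zero]
      rintro ⟨h1, -⟩
      have : (0 : ℝ) ≤ j := by positivity
      rw [zero_div] at h1
      linarith
    · unfold cellSum
      rw [Finset.sum_eq_zero, mul_zero]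
      intro j hj
      rw [p₀.eq_zero, mul_zero]
      rintro ⟨-, h1⟩
      have : ((j + 1 : ℕ) : ℝ) ≤ N := by exact_mod_cast Finset.mem_range.1 hj
      rw [hTl] at h1
      push_cast at this
      linarith
  refine ⟨J, ℓ⁻¹ • p₁.average T ℓ N, ℓ⁻¹ • ℓ⁻¹ • p₂.average T ℓ N, S, hnJ, ?_, ?_, hSnorm,
    ?_, ?_, ?_⟩
  · rw [norm_smul, Real.norm_of_nonneg (by positivity)]
    gcongr
    exact p₁.norm_average_le T hℓ N
  · rw [norm_smul, norm_smul, Real.norm_of_nonneg (by positivity)]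
    gcongr
    exact p₂.norm_average_le T hℓ N
  · intro f
    set a : ℕ → ℝ := fun j => inner ℝ (Profile.unit.cell T ℓ j) f with ha
    have hd1 := deriv_cellSum (hψ.differentiable (by simp)) ℓ N a
    have hd2 : deriv (deriv (cellSum p₀.fn ℓ N a))
        = fun t => ℓ⁻¹ * (ℓ⁻¹ * cellSum (deriv (deriv p₀.fn)) ℓ N a t) := by
      rw [hd1]
      ext t
      rw [deriv_const_mul_field, deriv_cellSum (hψ'.differentiable (by simp))]
    refine ⟨cellSum p₀.fn ℓ N a, contDiff_cellSum hψ ℓ N a, (hvanish a).1, (hvanish a).2,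
      hJ ▸ p₀.average_ae_eq T ℓ N f, ?_, ?_⟩
    · rw [hd1]
      filter_upwards [p₁.average_ae_eq T ℓ N f, Lp.coeFn_smul ℓ⁻¹ (p₁.average T ℓ N f)]
        with t h1 h2
      rw [smul_apply, h2, Pi.smul_apply, h1, smul_eq_mul, hp₁]
      rfl
    · rw [hd2]
      filter_upwards [p₂.average_ae_eq T ℓ N f, Lp.coeFn_smul ℓ⁻¹ (p₂.average T ℓ N f),
        Lp.coeFn_smul ℓ⁻¹ (ℓ⁻¹ • p₂.average T ℓ N f)] with t h1 h2 h3
      rw [smul_apply, smul_apply, h3, Pi.smul_apply, h2, Pi.smul_apply, h1, smul_eq_mul,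
        smul_eq_mul, hp₂]
      rfl
  · intro f F hF hfF
    set a : ℕ → ℝ := fun j => inner ℝ (Profile.unit.cell T ℓ j) f with ha
    set K : ℝ → ℝ := fun t => F t - cellSum p₀.fn ℓ N a t with hK
    have hKs : ContDiff ℝ ∞ K := hF.sub (contDiff_cellSum hψ ℓ N a)
    have hKeq : (f - J f : TimeL2 T) =ᵐ[(volume : Measure ℝ).restrict (Icc 0 T)] K := by
      filter_upwards [Lp.coeFn_sub f (J f), hfF, p₀.average_ae_eq T ℓ N f] with t h1 h2 h3
      rw [h1, Pi.sub_apply, h2, hJ, h3]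
      rfl
    have hder : ∀ t, HasDerivAt (fun u => ∫ s in (0 : ℝ)..u, K s) (K t) t := fun t =>
      intervalIntegral.integral_hasDerivAt_right (hKs.continuous.intervalIntegrable _ _)
        (hKs.continuous.stronglyMeasurableAtFilter _ _) hKs.continuous.continuousAt
    have hderiv : deriv (fun u => ∫ s in (0 : ℝ)..u, K s) = K := funext fun t => (hder t).deriv
    refine ⟨fun u => ∫ s in (0 : ℝ)..u, K s, ?_, ?_, ?_, ?_, ?_⟩
    · rw [contDiff_infty_iff_deriv, hderiv]
      exact ⟨fun t => (hder t).differentiableAt, hKs⟩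
    · simp
    · change ∫ s in (0 : ℝ)..T, K s = 0
      rw [← primitive_congr hKeq ⟨hT, le_rfl⟩]
      exact (congrArg _ hN.symm).trans (primitive_cell_endpoint hℓ hN (horth f) le_rfl)
    · rw [hSapply]
      change (memLp_primitive (f - J f)).toLp =ᵐ[_] _
      filter_upwards [(memLp_primitive (f - J f)).coeFn_toLp, ae_restrict_mem measurableSet_Icc]
        with t h1 h2
      rw [h1, primitive_congr hKeq h2]
    · rw [hderiv]
      exact hKeq
  -- A single cell: `J f` is a multiple of the integral of `f`.
  · rintro rfl f hf
    have hN1 : (N : ℝ) = 1 := by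
      have : (N : ℝ) * ℓ = 1 * ℓ := by rw [hN, one_mul]
      exact mul_right_cancel₀ hℓ.ne' this
    have hN1' : N = 1 := by exact_mod_cast hN1
    subst hN1'
    rw [hJ, Profile.average_apply, Finset.sum_range_one, inner_unit_cell hℓ hN (Nat.zero_lt_one)]
    have : ∫ s in ((0 : ℕ) * ℓ : ℝ)..((0 + 1 : ℕ) * ℓ), (Icc 0 ℓ).indicator f s = 0 := by
      refine Eq.trans ?_ hf
      rw [integral_Icc_eq_integral_Ioc]
      simp only [Nat.cast_zero, zero_mul, zero_add, Nat.cast_one, one_mul]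
      rw [intervalIntegral.integral_of_le hT]
      refine setIntegral_congr_fun measurableSet_Ioc fun s hs => ?_
      rw [indicator_of_mem (Ioc_subset_Icc_self hs)]
    rw [this]
    simp

/-- The constants depend only on the bump function, not on `T` or the cells. -/
theorem exists_localSolver : ∃ c₀ c₁ c₂ : ℝ, 0 ≤ c₀ ∧ 0 ≤ c₁ ∧ 0 ≤ c₂ ∧
    ∀ (T ℓ : ℝ) (N : ℕ), 0 < ℓ → N * ℓ = T →
      ∃ J J₁ J₂ S : TimeL2 T →L[ℝ] TimeL2 T, IsLocalSolver T ℓ c₀ c₁ c₂ J J₁ J₂ S := by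
  obtain ⟨ψ, hψ, hcs, hsub, hint⟩ := exists_smooth_unit_bump
  have hψ' : ContDiff ℝ ∞ (deriv ψ) := (contDiff_infty_iff_deriv.1 hψ).2
  have hψ'' : ContDiff ℝ ∞ (deriv (deriv ψ)) := (contDiff_infty_iff_deriv.1 hψ').2
  have htd : ∀ φ : ℝ → ℝ, tsupport (deriv φ) ⊆ tsupport φ := fun φ =>
    closure_minimal support_deriv_subset (isClosed_tsupport φ)
  obtain ⟨p₀, rfl⟩ := exists_profile hψ.continuous hcs hsub
  obtain ⟨p₁, hp₁⟩ := exists_profile hψ'.continuous hcs.deriv ((htd _).trans hsub)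
  obtain ⟨p₂, hp₂⟩ := exists_profile hψ''.continuous hcs.deriv.deriv
    ((htd _).trans ((htd _).trans hsub))
  refine ⟨p₀.bound, p₁.bound, p₂.bound, p₀.bound_nonneg, p₁.bound_nonneg, p₂.bound_nonneg,
    fun T ℓ N hℓ hN => exists_isLocalSolver hψ hp₁ hp₂ hint hℓ hN⟩

/-! ### Diagonal operators on a Hilbert sum -/

section Diagonal

variable {E G ι : Type*} [NormedAddCommGroup E] [InnerProductSpace ℝ E] [CompleteSpace E]
  [NormedAddCommGroup G] [InnerProductSpace ℝ G] {V : ι → G →ₗᵢ[ℝ] E}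

/-- A uniformly bounded family of operators on the summands defines an operator on the Hilbert
sum. -/
theorem exists_diagonal (hV : IsHilbertSum ℝ (fun _ : ι => G) V) (B : ι → G →L[ℝ] G) {K : ℝ}
    (hK : 0 ≤ K) (hB : ∀ i, ‖B i‖ ≤ K) :
    ∃ D : E →L[ℝ] E, ‖D‖ ≤ K ∧ ∀ i φ, D (V i φ) = V i (B i φ) := by
  classical
  let U := hV.linearIsometryEquiv
  let M := lp.mapCLM 2 B hK hB
  refine ⟨(U.symm : lp (fun _ : ι => G) 2 →L[ℝ] E) ∘L M ∘L (U : E →L[ℝ] lp (fun _ : ι => G) 2),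
    ?_, fun i φ => ?_⟩
  · refine ContinuousLinearMap.opNorm_le_bound _ hK fun x => ?_
    have h1 := M.le_of_opNorm_le (lp.norm_mapCLM_le 2 B hK hB) (U x)
    rw [U.norm_map] at h1
    refine le_trans (le_of_eq ?_) h1
    exact U.symm.norm_map _
  · have h1 : U (V i φ) = lp.single 2 i φ := by
      have := hV.linearIsometryEquiv_symm_apply_single (i := i) φ
      exact ((LinearIsometryEquiv.symm_apply_eq _).1 this).symm
    have h2 : M (lp.single 2 i φ) = lp.single 2 i (B i φ) := by
      refine lp.ext (funext fun j => ?_)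
      change B j ((lp.single 2 i φ : lp (fun _ : ι => G) 2) j) = _
      by_cases hj : j = i
      · subst hj
        simp
      · rw [lp.single_apply_ne _ _ _ hj, lp.single_apply_ne _ _ _ hj, map_zero]
    change U.symm (M (U (V i φ))) = _
    rw [h1, h2]
    exact hV.linearIsometryEquiv_symm_apply_single _

/-- A closed subspace that contains the images of a dense set of vectors of every summand contains
all images. -/
theorem forall_mem_of_isHilbertSum (hV : IsHilbertSum ℝ (fun _ : ι => G) V) {F : Type*}
    [NormedAddCommGroup F] [NormedSpace ℝ F] (W : Submodule ℝ F) (hW : IsClosed (W : Set F))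
    (Φ : E →L[ℝ] F) {D : Set G} (hD : Dense D) (h : ∀ i, ∀ φ ∈ D, Φ (V i φ) ∈ W) (u : E) :
    Φ u ∈ W := by
  have h1 : ∀ i φ, Φ (V i φ) ∈ W := by
    intro i φ
    have hcl : IsClosed {φ : G | Φ (V i φ) ∈ W} :=
      hW.preimage (Φ.continuous.comp (V i).continuous)
    have := closure_minimal (fun φ hφ => h i φ hφ : D ⊆ {φ : G | Φ (V i φ) ∈ W}) hcl
    exact this (hD φ)
  have h2 := hV.hasSum_linearIsometryEquiv_symm (hV.linearIsometryEquiv u)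
  rw [LinearIsometryEquiv.symm_apply_apply] at h2
  have h3 := h2.mapL Φ
  exact hW.mem_of_tendsto h3 (Eventually.of_forall fun s => W.sum_mem fun i _ => h1 i _)

end Diagonal

/-! ### Tensor products and slices in `L²` of a product -/

section Tensor

variable {Ω X : Type*} [MeasurableSpace Ω] [MeasurableSpace X] {ν : Measure Ω} {μ : Measure X}

theorem enorm_sq_eq_lintegral (u : Lp ℝ 2 ν) : ‖u‖ₑ ^ 2 = ∫⁻ z, ‖u z‖ₑ ^ 2 ∂ν := by
  rw [Lp.enorm_def]
  have := eLpNorm_nnreal_pow_eq_lintegral (f := u) (μ := ν) (p := 2) (by norm_num)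
  simpa using this

theorem memLp_two_prod_mul {a : Ω → ℝ} {b : X → ℝ} (ha : MemLp a 2 ν) (hb : MemLp b 2 μ) :
    MemLp (fun z : Ω × X => a z.1 * b z.2) 2 (ν.prod μ) := by
  have hm : AEStronglyMeasurable (fun z : Ω × X => a z.1 * b z.2) (ν.prod μ) :=
    ha.1.comp_fst.mul hb.1.comp_snd
  rw [memLp_two_iff_integrable_sq hm]
  simp only [mul_pow]
  exact ((memLp_two_iff_integrable_sq ha.1).1 ha).mul_prod ((memLp_two_iff_integrable_sq hb.1).1 hb)

theorem prod_mul_ae_eq {a a' : Ω → ℝ} {b b' : X → ℝ} (ha : a =ᵐ[ν] a') (hb : b =ᵐ[μ] b') :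
    (fun z : Ω × X => a z.1 * b z.2) =ᵐ[ν.prod μ] fun z => a' z.1 * b' z.2 := by
  filter_upwards [Measure.quasiMeasurePreserving_fst.ae ha,
    Measure.quasiMeasurePreserving_snd.ae hb] with z h1 h2
  rw [h1, h2]

variable [SFinite ν] [SFinite μ]

theorem toLp_prod_mul_inner (φ φ' : Lp ℝ 2 ν) (ψ ψ' : Lp ℝ 2 μ) :
    inner ℝ (memLp_two_prod_mul (Lp.memLp φ) (Lp.memLp ψ)).toLp
      (memLp_two_prod_mul (Lp.memLp φ') (Lp.memLp ψ')).toLp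
      = (inner ℝ φ φ' : ℝ) * inner ℝ ψ ψ' := by
  rw [inner_toLp_eq_integral_mul, inner_eq_integral_mul, inner_eq_integral_mul,
    ← integral_prod_mul]
  congr 1
  ext z
  ring

/-- The tensor product `(φ ⊗ ψ)(t, x) = φ(t) ψ(x)` of functions in `L²`. -/
def tensor (ν : Measure Ω) (μ : Measure X) [SFinite ν] [SFinite μ] :
    Lp ℝ 2 ν →L[ℝ] Lp ℝ 2 μ →L[ℝ] Lp ℝ 2 (ν.prod μ) :=
  LinearMap.mkContinuous₂
    (LinearMap.mk₂ ℝ (fun φ ψ => (memLp_two_prod_mul (Lp.memLp φ) (Lp.memLp ψ)).toLp)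
      (fun φ φ' ψ => by
        rw [← MemLp.toLp_add]
        refine MemLp.toLp_congr _ _ ((prod_mul_ae_eq (Lp.coeFn_add φ φ') EventuallyEq.rfl).trans ?_)
        exact Eventually.of_forall fun z => add_mul _ _ _)
      (fun c φ ψ => by
        rw [← MemLp.toLp_const_smul]
        refine MemLp.toLp_congr _ _ ((prod_mul_ae_eq (Lp.coeFn_smul c φ) EventuallyEq.rfl).trans ?_)
        exact Eventually.of_forall fun z => mul_assoc _ _ _)
      (fun φ ψ ψ' => by
        rw [← MemLp.toLp_add]
        refine MemLp.toLp_congr _ _ ((prod_mul_ae_eq EventuallyEq.rfl (Lp.coeFn_add ψ ψ')).trans ?_)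
        exact Eventually.of_forall fun z => mul_add _ _ _)
      (fun c φ ψ => by
        rw [← MemLp.toLp_const_smul]
        refine MemLp.toLp_congr _ _ ((prod_mul_ae_eq EventuallyEq.rfl (Lp.coeFn_smul c ψ)).trans ?_)
        exact Eventually.of_forall fun z => mul_left_comm _ _ _))
    1 (fun φ ψ => by
      rw [one_mul]
      refine le_of_sq_le_sq (le_of_eq ?_) (by positivity)
      rw [← real_inner_self_eq_norm_sq, mul_pow, ← real_inner_self_eq_norm_sq φ,
        ← real_inner_self_eq_norm_sq ψ]
      exact toLp_prod_mul_inner φ φ ψ ψ)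

theorem coeFn_tensor (φ : Lp ℝ 2 ν) (ψ : Lp ℝ 2 μ) :
    tensor ν μ φ ψ =ᵐ[ν.prod μ] fun z => φ z.1 * ψ z.2 :=
  MemLp.coeFn_toLp (memLp_two_prod_mul (Lp.memLp φ) (Lp.memLp ψ))

theorem inner_tensor_tensor (φ φ' : Lp ℝ 2 ν) (ψ ψ' : Lp ℝ 2 μ) :
    inner ℝ (tensor ν μ φ ψ) (tensor ν μ φ' ψ') = (inner ℝ φ φ' : ℝ) * inner ℝ ψ ψ' :=
  toLp_prod_mul_inner φ φ' ψ ψ'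

theorem norm_tensor (φ : Lp ℝ 2 ν) (ψ : Lp ℝ 2 μ) : ‖tensor ν μ φ ψ‖ = ‖φ‖ * ‖ψ‖ := by
  rw [← sq_eq_sq₀ (norm_nonneg _) (by positivity), ← real_inner_self_eq_norm_sq,
    inner_tensor_tensor, mul_pow, real_inner_self_eq_norm_sq, real_inner_self_eq_norm_sq]

/-- The coefficient `t ↦ ⟨ψ, u(t, ·)⟩` of `u`, defined as the adjoint of `φ ↦ φ ⊗ ψ`. -/
def coef (ψ : Lp ℝ 2 μ) : Lp ℝ 2 (ν.prod μ) →L[ℝ] Lp ℝ 2 ν :=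
  ContinuousLinearMap.adjoint ((tensor ν μ).flip ψ)

theorem inner_coef (ψ : Lp ℝ 2 μ) (φ : Lp ℝ 2 ν) (u : Lp ℝ 2 (ν.prod μ)) :
    inner ℝ φ (coef ψ u) = inner ℝ (tensor ν μ φ ψ) u := by
  rw [coef, ContinuousLinearMap.adjoint_inner_right]
  rfl

theorem coef_tensor (ψ ψ' : Lp ℝ 2 μ) (φ : Lp ℝ 2 ν) :
    coef ψ (tensor ν μ φ ψ') = (inner ℝ ψ ψ' : ℝ) • φ := by
  refine ext_inner_left ℝ fun χ => ?_
  rw [inner_coef, inner_tensor_tensor, inner_smul_right, mul_comm]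

theorem ae_memLp_slice (u : Lp ℝ 2 (ν.prod μ)) : ∀ᵐ t ∂ν, MemLp (fun x => u (t, x)) 2 μ := by
  have h1 := (memLp_two_iff_integrable_sq (Lp.aestronglyMeasurable u)).1 (Lp.memLp u)
  filter_upwards [h1.prod_right_ae, (Lp.aestronglyMeasurable u).prodMk_left] with t ht1 ht2
  exact (memLp_two_iff_integrable_sq ht2).2 ht1

theorem coef_ae_eq_integral [IsFiniteMeasure ν] (ψ : Lp ℝ 2 μ) (u : Lp ℝ 2 (ν.prod μ)) :
    coef ψ u =ᵐ[ν] fun t => ∫ x, ψ x * u (t, x) ∂μ := by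
  have h1 : MemLp (fun z : Ω × X => (1 : ℝ) * ψ z.2) 2 (ν.prod μ) :=
    memLp_two_prod_mul (memLp_const 1) (Lp.memLp ψ)
  have hint : Integrable (fun z : Ω × X => ψ z.2 * u z) (ν.prod μ) := by
    have := h1.integrable_mul (Lp.memLp u)
    simp only [one_mul] at this
    exact this
  refine Integrable.ae_eq_of_forall_setIntegral_eq _ _ ?_ hint.integral_prod_left ?_
  · exact (Lp.memLp _).integrable (by norm_num)
  · intro s hs hs'
    have hm : MemLp (s.indicator fun _ => (1 : ℝ)) 2 ν :=
      memLp_indicator_const 2 hs 1 (Or.inr hs'.ne)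
    have h2 : ∫ t in s, (coef ψ u : Lp ℝ 2 ν) t ∂ν = inner ℝ hm.toLp (coef ψ u) := by
      rw [inner_eq_integral_mul, ← integral_indicator hs]
      refine integral_congr_ae ?_
      filter_upwards [hm.coeFn_toLp] with t ht
      rw [ht]
      by_cases h : t ∈ s <;> simp [h]
    rw [h2, inner_coef, inner_eq_integral_mul]
    have h3 : ∫ z, tensor ν μ hm.toLp ψ z * u z ∂(ν.prod μ)
        = ∫ z, (s ×ˢ univ).indicator (fun z : Ω × X => ψ z.2 * u z) z ∂(ν.prod μ) := by
      refine integral_congr_ae ?_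
      filter_upwards [coeFn_tensor hm.toLp ψ, prod_mul_ae_eq hm.coeFn_toLp
        (EventuallyEq.refl _ ψ)] with z hz1 hz2
      rw [hz1, hz2]
      by_cases h : z.1 ∈ s <;> simp [h, indicator]
    rw [h3, integral_indicator (hs.prod MeasurableSet.univ), setIntegral_prod _ hint.integrableOn]
    simp

end Tensor

section Slices

variable {X : Type*} [MeasurableSpace X] {μ : Measure X} {T : ℝ}

theorem coeFn_slice {u : Lp ℝ 2 (spaceTime T μ)} {t : ℝ} (h : MemLp (fun x => u (t, x)) 2 μ) :
    slice u t =ᵐ[μ] fun x => u (t, x) := by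
  rw [slice, dif_pos h]
  exact h.coeFn_toLp

variable [SFinite μ]

theorem coef_ae_eq_inner_slice (ψ : Lp ℝ 2 μ) (u : Lp ℝ 2 (spaceTime T μ)) :
    ∀ᵐ t ∂((volume : Measure ℝ).restrict (Icc 0 T)),
      (coef ψ u : TimeL2 T) t = inner ℝ ψ (slice u t) := by
  filter_upwards [coef_ae_eq_integral ψ u, ae_memLp_slice u] with t h1 h2
  rw [h1, inner_eq_integral_mul]
  refine integral_congr_ae ?_
  filter_upwards [coeFn_slice h2] with x hx
  rw [hx]

theorem lintegral_enorm_slice_sq (u : Lp ℝ 2 (spaceTime T μ)) :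
    ∫⁻ t in Icc 0 T, ‖slice u t‖ₑ ^ 2 = ‖u‖ₑ ^ 2 := by
  rw [enorm_sq_eq_lintegral, lintegral_prod _ (by
    exact ((Lp.aestronglyMeasurable u).enorm.pow_const 2))]
  refine lintegral_congr_ae ?_
  filter_upwards [ae_memLp_slice u] with t ht
  rw [enorm_sq_eq_lintegral]
  refine lintegral_congr_ae ?_
  filter_upwards [coeFn_slice ht] with x hx
  rw [hx]

variable {ι : Type*} (e : HilbertBasis ι ℝ (Lp ℝ 2 μ))

/-- The embedding `φ ↦ φ ⊗ e i` of the `i`-th mode. -/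
def mode (T : ℝ) (i : ι) : TimeL2 T →ₗᵢ[ℝ] Lp ℝ 2 (spaceTime T μ) where
  toLinearMap := ((tensor ((volume : Measure ℝ).restrict (Icc 0 T)) μ).flip (e i)).toLinearMap
  norm_map' φ := (norm_tensor φ (e i)).trans (by rw [e.orthonormal.1 i, mul_one])

theorem mode_apply (i : ι) (φ : TimeL2 T) :
    mode e T i φ = tensor ((volume : Measure ℝ).restrict (Icc 0 T)) μ φ (e i) := rfl

theorem eq_zero_of_coef_eq_zero [Countable ι] {u : Lp ℝ 2 (spaceTime T μ)}
    (h : ∀ i, (coef (e i) u : TimeL2 T) = 0) : u = 0 := by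
  have h1 : ∀ᵐ t ∂((volume : Measure ℝ).restrict (Icc 0 T)), ∀ i,
      inner ℝ (e i) (slice u t) = 0 := by
    rw [ae_all_iff]
    intro i
    filter_upwards [coef_ae_eq_inner_slice (e i) u, Lp.coeFn_zero ℝ 2
      ((volume : Measure ℝ).restrict (Icc 0 T))] with t ht ht0
    rw [← ht, h i, ht0]
    rfl
  have h2 : ‖u‖ₑ ^ 2 = 0 := by
    rw [← lintegral_enorm_slice_sq, lintegral_eq_zero_of_ae_eq_zero]
    filter_upwards [h1] with t ht
    have : slice u t = 0 := by
      refine e.repr.injective (lp.ext (funext fun i => ?_))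
      rw [e.repr_apply_apply, ht i, map_zero]
      rfl
    simp [this]
  simpa using h2

theorem isHilbertSum_mode [Countable ι] :
    IsHilbertSum ℝ (fun _ : ι => TimeL2 T) (mode e T) := by
  refine IsHilbertSum.mk (fun i j hij φ ψ => ?_) ?_
  · rw [mode_apply, mode_apply, inner_tensor_tensor, e.orthonormal.2 hij, mul_zero]
  · rw [top_le_iff, Submodule.topologicalClosure_eq_top_iff, eq_bot_iff]
    intro u hu
    refine eq_zero_of_coef_eq_zero e fun i => ext_inner_left ℝ fun φ => ?_
    rw [inner_coef, inner_zero_right]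
    exact hu _ (Submodule.mem_iSup_of_mem i ⟨φ, rfl⟩)

theorem coef_mode (i j : ι) (φ : TimeL2 T) [Decidable (i = j)] :
    (coef (e i) (mode e T j φ) : TimeL2 T) = if i = j then φ else 0 := by
  rw [mode_apply, coef_tensor]
  split_ifs with h
  · subst h
    rw [real_inner_self_eq_norm_sq, e.orthonormal.1 i]
    simp
  · rw [e.orthonormal.2 h, zero_smul]

end Slices

/-! ### The energy in terms of the square root of the operator -/

section Energy

variable {H : Type*} [NormedAddCommGroup H] [InnerProductSpace ℝ H] {A : H →ₗ.[ℝ] H} {ι : Type*}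

local notation "⟪" x ", " y "⟫" => inner ℝ x y

namespace EigenBasis

variable (B : EigenBasis A ι)

theorem basis_mem (i : ι) :
    ∃ h : B.basis i ∈ A.domain, A ⟨B.basis i, h⟩ = (-B.lam i) • B.basis i := by
  classical
  refine B.mem_domain _ _ fun j => ?_
  rw [inner_smul_right, orthonormal_iff_ite.1 B.basis.orthonormal]
  split_ifs with h
  · rw [h]
  · simp

/-- `w = √(-A) u`, stated for the coefficients. -/
def IsSqrt (u w : H) : Prop := ∀ i, ⟪B.basis i, w⟫ = √(B.lam i) * ⟪B.basis i, u⟫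

theorem IsSqrt.sub {B : EigenBasis A ι} {u w u' w' : H} (h : B.IsSqrt u w) (h' : B.IsSqrt u' w') :
    B.IsSqrt (u - u') (w - w') := fun i => by
  rw [inner_sub_right, inner_sub_right, h i, h' i, mul_sub]

theorem IsSqrt.unique {B : EigenBasis A ι} {u w w' : H} (h : B.IsSqrt u w) (h' : B.IsSqrt u w') :
    w = w' :=
  B.basis.repr.injective (lp.ext (funext fun i => by
    rw [B.basis.repr_apply_apply, B.basis.repr_apply_apply, h i, h' i]))

theorem preForm_eq_norm_sq {B : EigenBasis A ι} {u : A.domain} {w : H} (h : B.IsSqrt u w) :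
    preForm A u = ‖w‖ ^ 2 := by
  rw [preForm, ← real_inner_self_eq_norm_sq, ← B.basis.tsum_inner_mul_inner w w,
    ← B.basis.tsum_inner_mul_inner (u : H) (A u), ← tsum_neg]
  refine tsum_congr fun i => ?_
  rw [B.inner_apply, real_inner_comm, real_inner_comm _ w, h i]
  rw [mul_mul_mul_comm, Real.mul_self_sqrt (B.lam_nonneg i)]
  ring

/-- The energy of `u` is at most `‖√(-A) u‖²`: the partial sums of the eigenfunction expansion are
admissible in the definition of the energy. -/
theorem energy_le [Countable ι] {B : EigenBasis A ι} {u w : H} (h : B.IsSqrt u w) :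
    energy A u ≤ ‖w‖ₑ ^ 2 := by
  obtain ⟨s, hs⟩ := exists_seq_tendsto (atTop : Filter (Finset ι))
  have hmem : ∀ n, ∑ i ∈ s n, B.basis.repr u i • B.basis i ∈ A.domain := fun n =>
    Submodule.sum_mem _ fun i _ => Submodule.smul_mem _ _ (B.basis_mem i).1
  set U : ℕ → A.domain := fun n => ⟨_, hmem n⟩ with hU
  set W : ℕ → H := fun n => ∑ i ∈ s n, B.basis.repr w i • B.basis i with hW
  have hUlim : Tendsto (fun n => (U n : H)) atTop (𝓝 u) := (B.basis.hasSum_repr u).comp hs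
  have hWlim : Tendsto W atTop (𝓝 w) := (B.basis.hasSum_repr w).comp hs
  have hsqrt : ∀ n, B.IsSqrt (U n) (W n) := fun n j => by
    classical
    simp only [hU, hW, inner_sum, inner_smul_right, Finset.mul_sum]
    refine Finset.sum_congr rfl fun i _ => ?_
    rw [orthonormal_iff_ite.1 B.basis.orthonormal, B.basis.repr_apply_apply,
      B.basis.repr_apply_apply, h i]
    split_ifs with hij
    · rw [hij]; ring
    · ring
  have h1 : ∀ p : ℕ × ℕ, preForm A (U p.1 - U p.2) = ‖W p.1 - W p.2‖ ^ 2 := fun p =>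
    preForm_eq_norm_sq ((hsqrt p.1).sub (hsqrt p.2))
  have h2 : Tendsto (fun p : ℕ × ℕ => preForm A (U p.1 - U p.2)) atTop (𝓝 0) := by
    simp only [h1]
    rw [← prod_atTop_atTop_eq]
    have := (((hWlim.comp tendsto_fst).sub (hWlim.comp tendsto_snd)).norm.pow 2 :
      Tendsto (fun p : ℕ × ℕ => ‖W p.1 - W p.2‖ ^ 2) (atTop ×ˢ atTop) _)
    simpa using this
  have h3 : Tendsto (fun n => preForm A (U n)) atTop (𝓝 (‖w‖ ^ 2)) := by
    simp only [fun n => preForm_eq_norm_sq (hsqrt n)]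
    exact hWlim.norm.pow 2
  refine (iInf₂_le (‖w‖ ^ 2) ⟨U, ⟨hUlim, h2⟩, h3⟩).trans (le_of_eq ?_)
  rw [← ofReal_norm, ENNReal.ofReal_pow (norm_nonneg _)]

/-- The bounded operator `√(-A) (1 - A)⁻¹`; it shows that `√(-A)` is continuous for the graph norm
of `A`. -/
theorem exists_sqrt_resolvent :
    ∃ Y : H →L[ℝ] H, ∀ u : A.domain, B.IsSqrt u (Y ((u : H) - A u)) := by
  have hb : ∀ i, ‖(√(B.lam i) / (1 + B.lam i)) • ContinuousLinearMap.id ℝ ℝ‖ ≤ 1 := fun i => by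
    have h0 := B.lam_nonneg i
    have h1 : √(B.lam i) ≤ 1 + B.lam i := by
      nlinarith [Real.sq_sqrt h0, sq_nonneg (√(B.lam i) - 1)]
    rw [norm_smul, ContinuousLinearMap.norm_id, mul_one, Real.norm_of_nonneg (by positivity)]
    exact div_le_one_of_le₀ h1 (by positivity)
  let M := lp.mapCLM 2 (fun i => (√(B.lam i) / (1 + B.lam i)) • ContinuousLinearMap.id ℝ ℝ)
    zero_le_one hb
  refine ⟨(B.basis.repr.symm : lp (fun _ : ι => ℝ) 2 →L[ℝ] H) ∘L M ∘L
    (B.basis.repr : H →L[ℝ] lp (fun _ : ι => ℝ) 2), fun u i => ?_⟩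
  have h1 : ∀ x : H, ((B.basis.repr.symm : lp (fun _ : ι => ℝ) 2 →L[ℝ] H) ∘L M ∘L
    (B.basis.repr : H →L[ℝ] lp (fun _ : ι => ℝ) 2)) x = B.basis.repr.symm (M (B.basis.repr x)) :=
    fun x => rfl
  have h2 : ∀ x : lp (fun _ : ι => ℝ) 2, M x i = (√(B.lam i) / (1 + B.lam i)) * x i := fun x => rfl
  rw [h1, ← B.basis.repr_apply_apply, LinearIsometryEquiv.apply_symm_apply, h2,
    B.basis.repr_apply_apply, inner_sub_right, B.inner_apply]
  have := B.lam_nonneg i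
  field_simp
  ring

end EigenBasis

end Energy

/-! ### Space-time relations as closed conditions -/

section SpaceTime

variable {X : Type*} [MeasurableSpace X] {μ : Measure X} [SFinite μ] {T : ℝ}
  {A : Lp ℝ 2 μ →ₗ.[ℝ] Lp ℝ 2 μ} {ι : Type*} (B : EigenBasis A ι)

theorem memLp_time {F : ℝ → ℝ} (hF : Continuous F) :
    MemLp F 2 ((volume : Measure ℝ).restrict (Icc 0 T)) := by
  obtain ⟨C, hC⟩ := isCompact_Icc.exists_bound_of_continuousOn (hF.continuousOn (s := Icc 0 T))
  exact MemLp.of_bound hF.aestronglyMeasurable C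
    ((ae_restrict_iff' measurableSet_Icc).2 (Eventually.of_forall hC))

theorem integral_mul_eq_inner_tensor {F : ℝ → ℝ} (hF : Continuous F) (ψ : Lp ℝ 2 μ)
    (u : Lp ℝ 2 (spaceTime T μ)) :
    ∫ z, u z * (F z.1 * ψ z.2) ∂(spaceTime T μ)
      = inner ℝ (tensor (volume.restrict (Icc 0 T)) μ (memLp_time hF).toLp ψ) u := by
  rw [inner_eq_integral_mul]
  refine integral_congr_ae ?_
  filter_upwards [coeFn_tensor (memLp_time (T := T) hF).toLp ψ,
    prod_mul_ae_eq (memLp_time (T := T) hF).coeFn_toLp (EventuallyEq.refl _ ψ)] with z h1 h2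
  rw [h1, h2, mul_comm]

theorem hasTimeDeriv_iff {u v : Lp ℝ 2 (spaceTime T μ)} :
    HasTimeDeriv u v ↔ ∀ (η : ℝ → ℝ) (ψ : Lp ℝ 2 μ) (hη : ContDiff ℝ ∞ η), HasCompactSupport η →
      tsupport η ⊆ Ioo 0 T →
      inner ℝ (tensor (volume.restrict (Icc 0 T)) μ
          (memLp_time (hη.continuous_deriv (by simp))).toLp ψ) u
        = -inner ℝ (tensor (volume.restrict (Icc 0 T)) μ (memLp_time hη.continuous).toLp ψ) v := by
  refine forall_congr' fun η => forall_congr' fun ψ => ⟨fun h hη h1 h2 => ?_, fun h hη h1 h2 => ?_⟩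
  · rw [← integral_mul_eq_inner_tensor (hη.continuous_deriv (by simp)),
      ← integral_mul_eq_inner_tensor hη.continuous]
    exact h hη h1 h2
  · rw [integral_mul_eq_inner_tensor (hη.continuous_deriv (by simp)),
      integral_mul_eq_inner_tensor hη.continuous]
    exact h hη h1 h2

theorem HasTimeDeriv.add {u v u' v' : Lp ℝ 2 (spaceTime T μ)} (h : HasTimeDeriv u v)
    (h' : HasTimeDeriv u' v') : HasTimeDeriv (u + u') (v + v') := by
  rw [hasTimeDeriv_iff] at *
  intro η ψ hη h1 h2
  rw [inner_add_right, inner_add_right, h η ψ hη h1 h2, h' η ψ hη h1 h2, neg_add]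

theorem HasTimeDeriv.smul {u v : Lp ℝ 2 (spaceTime T μ)} (c : ℝ) (h : HasTimeDeriv u v) :
    HasTimeDeriv (c • u) (c • v) := by
  rw [hasTimeDeriv_iff] at *
  intro η ψ hη h1 h2
  rw [inner_smul_right, inner_smul_right, h η ψ hη h1 h2, mul_neg]

theorem hasTimeDeriv_zero : HasTimeDeriv (0 : Lp ℝ 2 (spaceTime T μ)) 0 := by
  rw [hasTimeDeriv_iff]
  intro η ψ hη h1 h2
  simp

theorem isClosed_hasTimeDeriv :
    IsClosed {p : Lp ℝ 2 (spaceTime T μ) × Lp ℝ 2 (spaceTime T μ) | HasTimeDeriv p.1 p.2} := by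
  simp only [hasTimeDeriv_iff, ofPred_forall]
  refine isClosed_iInter fun η => isClosed_iInter fun ψ => isClosed_iInter fun hη =>
    isClosed_iInter fun h1 => isClosed_iInter fun h2 => isClosed_eq ?_ ?_ <;> fun_prop

theorem hasTimeDeriv_tensor {G : ℝ → ℝ} (hG : ContDiff ℝ ∞ G) {a b : TimeL2 T}
    (ha : a =ᵐ[volume.restrict (Icc 0 T)] G)
    (hb : b =ᵐ[volume.restrict (Icc 0 T)] deriv G) (φ : Lp ℝ 2 μ) (hT : 0 ≤ T) :
    HasTimeDeriv (tensor (volume.restrict (Icc 0 T)) μ a φ)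
      (tensor (volume.restrict (Icc 0 T)) μ b φ) := by
  rw [hasTimeDeriv_iff]
  intro η ψ hη h1 h2
  have hη' : Continuous (deriv η) := hη.continuous_deriv (by simp)
  have hG' : Continuous (deriv G) := hG.continuous_deriv (by simp)
  have hz : ∀ t, t ∉ Ioo 0 T → η t = 0 := fun t ht =>
    image_eq_zero_of_notMem_tsupport fun h => ht (h2 h)
  have key : inner ℝ (memLp_time (T := T) hη').toLp a
      = -inner ℝ (memLp_time (T := T) hη.continuous).toLp b := by
    rw [inner_eq_integral_mul, inner_eq_integral_mul]
    have e1 : ∫ t, ((memLp_time (T := T) hη').toLp (deriv η) : TimeL2 T) t * a t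
          ∂(volume.restrict (Icc 0 T)) = ∫ t in (0 : ℝ)..T, G t * deriv η t := by
      rw [intervalIntegral.integral_of_le hT, ← integral_Icc_eq_integral_Ioc]
      refine integral_congr_ae ?_
      filter_upwards [(memLp_time (T := T) hη').coeFn_toLp, ha] with t k1 k2
      rw [k1, k2, mul_comm]
    have e2 : ∫ t, ((memLp_time (T := T) hη.continuous).toLp η : TimeL2 T) t * b t
          ∂(volume.restrict (Icc 0 T)) = ∫ t in (0 : ℝ)..T, deriv G t * η t := by
      rw [intervalIntegral.integral_of_le hT, ← integral_Icc_eq_integral_Ioc]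
      refine integral_congr_ae ?_
      filter_upwards [(memLp_time (T := T) hη.continuous).coeFn_toLp, hb] with t k1 k2
      rw [k1, k2, mul_comm]
    rw [e1, e2, intervalIntegral.integral_mul_deriv_eq_deriv_mul
      (fun t _ => (hG.differentiable (by simp) t).hasDerivAt)
      (fun t _ => (hη.differentiable (by simp) t).hasDerivAt)
      (hG'.intervalIntegrable _ _) (hη'.intervalIntegrable _ _), hz 0 (by simp), hz T (by simp)]
    ring
  rw [inner_tensor_tensor, inner_tensor_tensor, key]
  ring

/-- `w = √(-A) u`, with `A` acting on the space variable, stated for the coefficients. -/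
def IsSpaceSqrt (u w : Lp ℝ 2 (spaceTime T μ)) : Prop :=
  ∀ i, (coef (B.basis i) w : TimeL2 T) = √(B.lam i) • coef (B.basis i) u

/-- `w = A u`, with `A` acting on the space variable, stated for the coefficients. -/
def IsSpaceOp (u w : Lp ℝ 2 (spaceTime T μ)) : Prop :=
  ∀ i, (coef (B.basis i) w : TimeL2 T) = (-B.lam i) • coef (B.basis i) u

variable {B}

theorem ae_inner_slice [Countable ι] {c : ι → ℝ} {u w : Lp ℝ 2 (spaceTime T μ)}
    (h : ∀ i, (coef (B.basis i) w : TimeL2 T) = c i • coef (B.basis i) u) :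
    ∀ᵐ t ∂(volume.restrict (Icc 0 T)), ∀ i,
      inner ℝ (B.basis i) (slice w t) = c i * inner ℝ (B.basis i) (slice u t) := by
  rw [ae_all_iff]
  intro i
  filter_upwards [coef_ae_eq_inner_slice (B.basis i) u, coef_ae_eq_inner_slice (B.basis i) w,
    Lp.coeFn_smul (c i) (coef (B.basis i) u : TimeL2 T)] with t h1 h2 h3
  rw [← h2, h i, h3, Pi.smul_apply, h1, smul_eq_mul]

theorem timeEnergy_le [Countable ι] {u w : Lp ℝ 2 (spaceTime T μ)} (h : IsSpaceSqrt B u w) :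
    timeEnergy A u ≤ ‖w‖ₑ ^ 2 := by
  rw [← lintegral_enorm_slice_sq]
  refine lintegral_mono_ae ?_
  filter_upwards [ae_inner_slice h] with t ht
  exact EigenBasis.energy_le ht

theorem timeEnergy_rpow_le [Countable ι] {u w : Lp ℝ 2 (spaceTime T μ)} (h : IsSpaceSqrt B u w) :
    timeEnergy A u ^ (1 / 2 : ℝ) ≤ ‖w‖ₑ := by
  refine (ENNReal.rpow_le_rpow (timeEnergy_le h) (by norm_num)).trans (le_of_eq ?_)
  rw [← ENNReal.rpow_natCast, ← ENNReal.rpow_mul]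
  norm_num

theorem IsSpaceOp.hasSpaceOp [Countable ι] {u w : Lp ℝ 2 (spaceTime T μ)} (h : IsSpaceOp B u w) :
    HasSpaceOp A u w := by
  filter_upwards [ae_inner_slice h] with t ht
  exact B.mem_domain _ _ ht

theorem isSpaceSqrt_tensor {φ ψ : Lp ℝ 2 μ} (h : B.IsSqrt φ ψ) (a : TimeL2 T) :
    IsSpaceSqrt B (tensor (volume.restrict (Icc 0 T)) μ a φ)
      (tensor (volume.restrict (Icc 0 T)) μ a ψ) := fun i => by
  rw [coef_tensor, coef_tensor, h i, mul_smul]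

theorem isSpaceOp_tensor (φ : A.domain) (a : TimeL2 T) :
    IsSpaceOp B (tensor (volume.restrict (Icc 0 T)) μ a φ)
      (tensor (volume.restrict (Icc 0 T)) μ a (A φ)) := fun i => by
  rw [coef_tensor, coef_tensor, B.inner_apply, mul_smul]

end SpaceTime

/-! ### The Sobolev spaces as projections of closed subspaces -/

theorem tendsto_enorm_sub {F : Type*} [NormedAddCommGroup F] {n : ℕ} {P : ℕ → Fin n → F}
    {p : Fin n → F} (h : Tendsto P atTop (𝓝 p)) (i : Fin n) :
    Tendsto (fun k => ‖(P k - p) i‖ₑ) atTop (𝓝 0) := by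
  have h1 : Tendsto (fun k => P k i - p i) atTop (𝓝 0) := by
    simpa using (tendsto_pi_nhds.1 h i).sub_const (p i)
  have h2 := (continuous_enorm.tendsto _).comp h1
  rw [enorm_zero] at h2
  exact h2

theorem exists_seq_of_mem_topologicalClosure {F : Type*} [NormedAddCommGroup F] [NormedSpace ℝ F]
    {W : Submodule ℝ F} {p : F} (h : p ∈ W.topologicalClosure) :
    ∃ P : ℕ → F, (∀ k, P k ∈ W) ∧ Tendsto P atTop (𝓝 p) :=
  mem_closure_iff_seq_limit.1 h

/-- Approximation of an element of `dom A` by smooth elements in the graph norm. -/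
theorem mem_closure_smooth {d : ℕ} {S : Set (EuclideanSpace ℝ (Fin d))}
    {μ : Measure (EuclideanSpace ℝ (Fin d))} {A : Lp ℝ 2 μ →ₗ.[ℝ] Lp ℝ 2 μ}
    (hcore : SmoothCore S A) (φ : A.domain) :
    ((φ : Lp ℝ 2 μ), A φ) ∈ closure {q : Lp ℝ 2 μ × Lp ℝ 2 μ | ∃ h : q.1 ∈ A.domain,
      A ⟨q.1, h⟩ = q.2 ∧ ∃ r : EuclideanSpace ℝ (Fin d) → ℝ, ContDiffOn ℝ ∞ r S ∧ q.1 =ᵐ[μ] r} := by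
  rw [Metric.mem_closure_iff]
  intro ε hε
  obtain ⟨ψ, hr, h1, h2⟩ := hcore φ ε hε
  refine ⟨(ψ, A ψ), ⟨ψ.2, rfl, hr⟩, ?_⟩
  rw [Prod.dist_eq, max_lt_iff, dist_comm, dist_eq_norm, dist_comm (A φ), dist_eq_norm]
  exact ⟨h1, h2⟩

section Graphs

variable {d : ℕ} {μ : Measure (EuclideanSpace ℝ (Fin d))} [SFinite μ] {T : ℝ}
  {A : Lp ℝ 2 μ →ₗ.[ℝ] Lp ℝ 2 μ} {ι : Type*}

theorem IsSpaceSqrt.add {B : EigenBasis A ι} {u w u' w' : Lp ℝ 2 (spaceTime T μ)}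
    (h : IsSpaceSqrt B u w) (h' : IsSpaceSqrt B u' w') : IsSpaceSqrt B (u + u') (w + w') :=
  fun i => by rw [map_add, map_add, h i, h' i, smul_add]

theorem IsSpaceSqrt.smul {B : EigenBasis A ι} {u w : Lp ℝ 2 (spaceTime T μ)} (c : ℝ)
    (h : IsSpaceSqrt B u w) : IsSpaceSqrt B (c • u) (c • w) :=
  fun i => by rw [map_smul, map_smul, h i, smul_comm]

theorem IsSpaceOp.add {B : EigenBasis A ι} {u w u' w' : Lp ℝ 2 (spaceTime T μ)}
    (h : IsSpaceOp B u w) (h' : IsSpaceOp B u' w') : IsSpaceOp B (u + u') (w + w') :=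
  fun i => by rw [map_add, map_add, h i, h' i, smul_add]

theorem IsSpaceOp.smul {B : EigenBasis A ι} {u w : Lp ℝ 2 (spaceTime T μ)} (c : ℝ)
    (h : IsSpaceOp B u w) : IsSpaceOp B (c • u) (c • w) :=
  fun i => by rw [map_smul, map_smul, h i, smul_comm]

theorem isClosed_isSpaceSqrt (B : EigenBasis A ι) :
    IsClosed {p : Lp ℝ 2 (spaceTime T μ) × Lp ℝ 2 (spaceTime T μ) | IsSpaceSqrt B p.1 p.2} := by
  simp only [IsSpaceSqrt, ofPred_forall]
  exact isClosed_iInter fun i => isClosed_eq (by fun_prop) (by fun_prop)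

theorem isClosed_isSpaceOp (B : EigenBasis A ι) :
    IsClosed {p : Lp ℝ 2 (spaceTime T μ) × Lp ℝ 2 (spaceTime T μ) | IsSpaceOp B p.1 p.2} := by
  simp only [IsSpaceOp, ofPred_forall]
  exact isClosed_iInter fun i => isClosed_eq (by fun_prop) (by fun_prop)

/-- The triples `(u, ∂ₜ u, √(-A) u)`. -/
def graph12 (B : EigenBasis A ι) (T : ℝ) : Submodule ℝ (Fin 3 → Lp ℝ 2 (spaceTime T μ)) where
  carrier := {p | HasTimeDeriv (p 0) (p 1) ∧ IsSpaceSqrt B (p 0) (p 2)}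
  add_mem' h h' := ⟨h.1.add h'.1, h.2.add h'.2⟩
  zero_mem' := ⟨hasTimeDeriv_zero, fun i => by simp⟩
  smul_mem' c _ h := ⟨h.1.smul c, h.2.smul c⟩

/-- The tuples `(u, ∂ₜ u, ∂ₜₜ u, A u, √(-A) u, √(-A) ∂ₜ u)`. -/
def graph22 (B : EigenBasis A ι) (T : ℝ) : Submodule ℝ (Fin 6 → Lp ℝ 2 (spaceTime T μ)) where
  carrier := {p | HasTimeDeriv (p 0) (p 1) ∧ HasTimeDeriv (p 1) (p 2) ∧ IsSpaceOp B (p 0) (p 3) ∧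
    IsSpaceSqrt B (p 0) (p 4) ∧ IsSpaceSqrt B (p 1) (p 5)}
  add_mem' h h' := ⟨h.1.add h'.1, h.2.1.add h'.2.1, h.2.2.1.add h'.2.2.1,
    h.2.2.2.1.add h'.2.2.2.1, h.2.2.2.2.add h'.2.2.2.2⟩
  zero_mem' := ⟨hasTimeDeriv_zero, hasTimeDeriv_zero, fun i => by simp, fun i => by simp,
    fun i => by simp⟩
  smul_mem' c _ h := ⟨h.1.smul c, h.2.1.smul c, h.2.2.1.smul c, h.2.2.2.1.smul c,
    h.2.2.2.2.smul c⟩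

theorem isClosed_graph12 (B : EigenBasis A ι) :
    IsClosed (graph12 B T : Set (Fin 3 → Lp ℝ 2 (spaceTime T μ))) := by
  have h1 : IsClosed {p : Fin 3 → Lp ℝ 2 (spaceTime T μ) | HasTimeDeriv (p 0) (p 1)} :=
    isClosed_hasTimeDeriv.preimage (f := fun p : Fin 3 → _ => (p 0, p 1)) (by fun_prop)
  have h2 : IsClosed {p : Fin 3 → Lp ℝ 2 (spaceTime T μ) | IsSpaceSqrt B (p 0) (p 2)} :=
    (isClosed_isSpaceSqrt B).preimage (f := fun p : Fin 3 → _ => (p 0, p 2)) (by fun_prop)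
  exact h1.inter h2

theorem isClosed_graph22 (B : EigenBasis A ι) :
    IsClosed (graph22 B T : Set (Fin 6 → Lp ℝ 2 (spaceTime T μ))) := by
  have h1 : IsClosed {p : Fin 6 → Lp ℝ 2 (spaceTime T μ) | HasTimeDeriv (p 0) (p 1)} :=
    isClosed_hasTimeDeriv.preimage (f := fun p : Fin 6 → _ => (p 0, p 1)) (by fun_prop)
  have h2 : IsClosed {p : Fin 6 → Lp ℝ 2 (spaceTime T μ) | HasTimeDeriv (p 1) (p 2)} :=
    isClosed_hasTimeDeriv.preimage (f := fun p : Fin 6 → _ => (p 1, p 2)) (by fun_prop)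
  have h3 : IsClosed {p : Fin 6 → Lp ℝ 2 (spaceTime T μ) | IsSpaceOp B (p 0) (p 3)} :=
    (isClosed_isSpaceOp B).preimage (f := fun p : Fin 6 → _ => (p 0, p 3)) (by fun_prop)
  have h4 : IsClosed {p : Fin 6 → Lp ℝ 2 (spaceTime T μ) | IsSpaceSqrt B (p 0) (p 4)} :=
    (isClosed_isSpaceSqrt B).preimage (f := fun p : Fin 6 → _ => (p 0, p 4)) (by fun_prop)
  have h5 : IsClosed {p : Fin 6 → Lp ℝ 2 (spaceTime T μ) | IsSpaceSqrt B (p 1) (p 5)} :=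
    (isClosed_isSpaceSqrt B).preimage (f := fun p : Fin 6 → _ => (p 1, p 5)) (by fun_prop)
  exact h1.inter (h2.inter (h3.inter (h4.inter h5)))

theorem norm12_le [Countable ι] {B : EigenBasis A ι} {p : Fin 3 → Lp ℝ 2 (spaceTime T μ)}
    (h : p ∈ graph12 B T) : norm12 A (p 0) ≤ ‖p 0‖ₑ + ‖p 2‖ₑ + ‖p 1‖ₑ := by
  unfold norm12
  gcongr
  · exact timeEnergy_rpow_le h.2
  · exact iInf₂_le _ h.1

theorem norm22_le [Countable ι] {B : EigenBasis A ι} {p : Fin 6 → Lp ℝ 2 (spaceTime T μ)}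
    (h : p ∈ graph22 B T) :
    norm22 A (p 0) ≤ ‖p 0‖ₑ + ‖p 4‖ₑ + ‖p 3‖ₑ + (‖p 1‖ₑ + ‖p 5‖ₑ + ‖p 2‖ₑ) := by
  unfold norm22
  refine add_le_add (add_le_add (add_le_add le_rfl (timeEnergy_rpow_le h.2.2.2.1)) ?_) ?_
  · exact iInf₂_le _ h.2.2.1.hasSpaceOp
  · refine (iInf₂_le _ h.1).trans ?_
    refine add_le_add (add_le_add le_rfl (timeEnergy_rpow_le h.2.2.2.2)) ?_
    exact iInf₂_le _ h.2.1

/-- The elements of `L²(λ ⊗ μ)` represented by smooth functions vanishing at times `0` and `T`. -/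
def smoothDirichlet (S : Set (EuclideanSpace ℝ (Fin d))) (μ : Measure (EuclideanSpace ℝ (Fin d)))
    (T : ℝ) : Submodule ℝ (Lp ℝ 2 (spaceTime T μ)) where
  carrier := {u | IsSmoothDirichlet S u}
  add_mem' := by
    rintro u v ⟨r, hr, hr0, hru⟩ ⟨s, hs, hs0, hsv⟩
    refine ⟨r + s, hr.add hs, fun x hx => ?_, ?_⟩
    · simp [hr0 x hx, hs0 x hx]
    · exact (Lp.coeFn_add u v).trans (hru.add hsv)
  zero_mem' := ⟨0, contDiffOn_const, fun x _ => by simp, Lp.coeFn_zero _ _ _⟩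
  smul_mem' := by
    rintro c u ⟨r, hr, hr0, hru⟩
    refine ⟨c • r, contDiffOn_const.smul hr, fun x hx => ?_, ?_⟩
    · simp [hr0 x hx]
    · exact (Lp.coeFn_smul c u).trans (hru.const_smul c)

/-- The closure of the triples `(u, ∂ₜ u, √(-A) u)` with `u` smooth and vanishing at times `0` and
`T`; its first projection is contained in `H^{1,2}_D`. -/
def closedGraph12 (S : Set (EuclideanSpace ℝ (Fin d))) (B : EigenBasis A ι) (T : ℝ) :
    Submodule ℝ (Fin 3 → Lp ℝ 2 (spaceTime T μ)) :=
  (graph12 B T ⊓ (smoothDirichlet S μ T).comap (LinearMap.proj 0)).topologicalClosure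

/-- The analogue of `closedGraph12` for `H^{2,2}_D`. -/
def closedGraph22 (S : Set (EuclideanSpace ℝ (Fin d))) (B : EigenBasis A ι) (T : ℝ) :
    Submodule ℝ (Fin 6 → Lp ℝ 2 (spaceTime T μ)) :=
  (graph22 B T ⊓ (smoothDirichlet S μ T).comap (LinearMap.proj 0)).topologicalClosure

variable {S : Set (EuclideanSpace ℝ (Fin d))} {B : EigenBasis A ι}

theorem closedGraph12_le : closedGraph12 S B T ≤ graph12 B T :=
  Submodule.topologicalClosure_minimal _ inf_le_left (isClosed_graph12 B)

theorem closedGraph22_le : closedGraph22 S B T ≤ graph22 B T :=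
  Submodule.topologicalClosure_minimal _ inf_le_left (isClosed_graph22 B)

theorem mem_sobolev12 [Countable ι] {p : Fin 3 → Lp ℝ 2 (spaceTime T μ)}
    (h : p ∈ closedGraph12 S B T) : p 0 ∈ sobolev12 S A := by
  have hfin : ∀ q ∈ graph12 B T, norm12 A (q 0) < ⊤ := fun q hq =>
    (norm12_le hq).trans_lt (by simp)
  obtain ⟨P, hP, hlim⟩ := exists_seq_of_mem_topologicalClosure h
  refine ⟨hfin p (closedGraph12_le h), fun k => P k 0,
    fun k => ⟨(hP k).2, hfin _ (hP k).1⟩, ?_⟩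
  have hle : ∀ k, norm12 A (P k 0 - p 0)
      ≤ ‖(P k - p) 0‖ₑ + ‖(P k - p) 2‖ₑ + ‖(P k - p) 1‖ₑ := fun k => by
    have h1 : P k - p ∈ graph12 B T := Submodule.sub_mem _ (hP k).1 (closedGraph12_le h)
    have h2 := norm12_le h1
    rwa [Pi.sub_apply] at h2 ⊢
  refine tendsto_of_tendsto_of_tendsto_of_le_of_le tendsto_const_nhds ?_ (fun _ => zero_le) hle
  simpa using ((tendsto_enorm_sub hlim 0).add (tendsto_enorm_sub hlim 2)).add
    (tendsto_enorm_sub hlim 1)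

theorem mem_sobolev22 [Countable ι] {p : Fin 6 → Lp ℝ 2 (spaceTime T μ)}
    (h : p ∈ closedGraph22 S B T) : p 0 ∈ sobolev22 S A := by
  have hfin : ∀ q ∈ graph22 B T, norm22 A (q 0) < ⊤ := fun q hq =>
    (norm22_le hq).trans_lt (by simp)
  obtain ⟨P, hP, hlim⟩ := exists_seq_of_mem_topologicalClosure h
  refine ⟨hfin p (closedGraph22_le h), fun k => P k 0,
    fun k => ⟨(hP k).2, hfin _ (hP k).1⟩, ?_⟩
  have hle : ∀ k, norm22 A (P k 0 - p 0)
      ≤ ‖(P k - p) 0‖ₑ + ‖(P k - p) 4‖ₑ + ‖(P k - p) 3‖ₑ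
        + (‖(P k - p) 1‖ₑ + ‖(P k - p) 5‖ₑ + ‖(P k - p) 2‖ₑ) := fun k => by
    have h1 : P k - p ∈ graph22 B T := Submodule.sub_mem _ (hP k).1 (closedGraph22_le h)
    have h2 := norm22_le h1
    rwa [Pi.sub_apply] at h2 ⊢
  refine tendsto_of_tendsto_of_tendsto_of_le_of_le tendsto_const_nhds ?_ (fun _ => zero_le) hle
  simpa using (((tendsto_enorm_sub hlim 0).add (tendsto_enorm_sub hlim 4)).add
    (tendsto_enorm_sub hlim 3)).add (((tendsto_enorm_sub hlim 1).add
      (tendsto_enorm_sub hlim 5)).add (tendsto_enorm_sub hlim 2))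

theorem isSmoothDirichlet_tensor {G : ℝ → ℝ} (hG : ContDiff ℝ ∞ G) (h0 : G 0 = 0) (hT : G T = 0)
    {a : TimeL2 T} (ha : a =ᵐ[volume.restrict (Icc 0 T)] G) {φ : Lp ℝ 2 μ}
    {r : EuclideanSpace ℝ (Fin d) → ℝ} (hr : ContDiffOn ℝ ∞ r S) (hφ : φ =ᵐ[μ] r) :
    IsSmoothDirichlet S (tensor (volume.restrict (Icc 0 T)) μ a φ : Lp ℝ 2 (spaceTime T μ)) := by
  refine ⟨fun z => G z.1 * r z.2, ?_, fun x _ => by simp [h0, hT],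
    (coeFn_tensor a φ).trans (prod_mul_ae_eq ha hφ)⟩
  exact (hG.comp_contDiffOn contDiffOn_fst).mul (hr.comp contDiffOn_snd fun z hz => hz.2)

/-- The tuple of a product `G(t) e i(x)`, with `G` smooth and vanishing at times `0` and `T`, and
`e i` an eigenvector of `A`. -/
theorem tensor_mem_closedGraph12 (hcore : SmoothCore S A) (hT0 : 0 ≤ T) {G : ℝ → ℝ}
    (hG : ContDiff ℝ ∞ G) (h0 : G 0 = 0) (hT : G T = 0) {a b : TimeL2 T}
    (ha : a =ᵐ[volume.restrict (Icc 0 T)] G) (hb : b =ᵐ[volume.restrict (Icc 0 T)] deriv G)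
    (i : ι) :
    ![mode B.basis T i a, mode B.basis T i b, mode B.basis T i (√(B.lam i) • a)]
      ∈ closedGraph12 S B T := by
  obtain ⟨Y, hY⟩ := B.exists_sqrt_resolvent
  obtain ⟨hmem, hAe⟩ := B.basis_mem i
  -- The tuple as a continuous function of `(φ, A φ)`, using `√(-A) φ = Y (φ - A φ)`.
  let Ψ : Lp ℝ 2 μ × Lp ℝ 2 μ → Fin 3 → Lp ℝ 2 (spaceTime T μ) := fun q =>
    ![tensor (volume.restrict (Icc 0 T)) μ a q.1, tensor (volume.restrict (Icc 0 T)) μ b q.1,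
      tensor (volume.restrict (Icc 0 T)) μ a (Y (q.1 - q.2))]
  have hΨ : Continuous Ψ := by
    refine continuous_pi fun k => ?_
    fin_cases k <;> simp [Ψ] <;> fun_prop
  have hsq : Y (B.basis i - A ⟨B.basis i, hmem⟩) = √(B.lam i) • B.basis i := by
    refine (hY ⟨B.basis i, hmem⟩).unique fun j => ?_
    classical
    rw [inner_smul_right, orthonormal_iff_ite.1 B.basis.orthonormal]
    split_ifs with h
    · rw [h]
    · simp
  have hval : Ψ (B.basis i, A ⟨B.basis i, hmem⟩)
      = ![mode B.basis T i a, mode B.basis T i b, mode B.basis T i (√(B.lam i) • a)] := by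
    simp only [Ψ, hsq, mode_apply, map_smul]
  rw [← hval]
  refine map_mem_closure hΨ (mem_closure_smooth hcore ⟨B.basis i, hmem⟩) ?_
  rintro q ⟨hq, hAq, r, hr, hqr⟩
  have h1 := hY ⟨q.1, hq⟩
  rw [hAq] at h1
  refine ⟨⟨hasTimeDeriv_tensor hG ha hb q.1 hT0, isSpaceSqrt_tensor h1 a⟩, ?_⟩
  exact isSmoothDirichlet_tensor hG h0 hT ha hr hqr

theorem tensor_mem_closedGraph22 (hcore : SmoothCore S A) (hT0 : 0 ≤ T) {G : ℝ → ℝ}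
    (hG : ContDiff ℝ ∞ G) (h0 : G 0 = 0) (hT : G T = 0) {a b c : TimeL2 T}
    (ha : a =ᵐ[volume.restrict (Icc 0 T)] G) (hb : b =ᵐ[volume.restrict (Icc 0 T)] deriv G)
    (hc : c =ᵐ[volume.restrict (Icc 0 T)] deriv (deriv G)) (i : ι) :
    ![mode B.basis T i a, mode B.basis T i b, mode B.basis T i c,
      mode B.basis T i ((-B.lam i) • a), mode B.basis T i (√(B.lam i) • a),
      mode B.basis T i (√(B.lam i) • b)] ∈ closedGraph22 S B T := by
  obtain ⟨Y, hY⟩ := B.exists_sqrt_resolvent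
  obtain ⟨hmem, hAe⟩ := B.basis_mem i
  have hG' : ContDiff ℝ ∞ (deriv G) := (contDiff_infty_iff_deriv.1 hG).2
  let Ψ : Lp ℝ 2 μ × Lp ℝ 2 μ → Fin 6 → Lp ℝ 2 (spaceTime T μ) := fun q =>
    ![tensor (volume.restrict (Icc 0 T)) μ a q.1, tensor (volume.restrict (Icc 0 T)) μ b q.1,
      tensor (volume.restrict (Icc 0 T)) μ c q.1, tensor (volume.restrict (Icc 0 T)) μ a q.2,
      tensor (volume.restrict (Icc 0 T)) μ a (Y (q.1 - q.2)),
      tensor (volume.restrict (Icc 0 T)) μ b (Y (q.1 - q.2))]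
  have hΨ : Continuous Ψ := by
    refine continuous_pi fun k => ?_
    fin_cases k <;> simp [Ψ] <;> fun_prop
  have hsq : Y (B.basis i - A ⟨B.basis i, hmem⟩) = √(B.lam i) • B.basis i := by
    refine (hY ⟨B.basis i, hmem⟩).unique fun j => ?_
    classical
    rw [inner_smul_right, orthonormal_iff_ite.1 B.basis.orthonormal]
    split_ifs with h
    · rw [h]
    · simp
  have hval : Ψ (B.basis i, A ⟨B.basis i, hmem⟩)
      = ![mode B.basis T i a, mode B.basis T i b, mode B.basis T i c,
          mode B.basis T i ((-B.lam i) • a), mode B.basis T i (√(B.lam i) • a),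
          mode B.basis T i (√(B.lam i) • b)] := by
    simp only [Ψ, hsq, mode_apply, map_smul]
    simp only [hAe, map_smul]
  rw [← hval]
  refine map_mem_closure hΨ (mem_closure_smooth hcore ⟨B.basis i, hmem⟩) ?_
  rintro q ⟨hq, hAq, r, hr, hqr⟩
  have h1 := hY ⟨q.1, hq⟩
  have h2 := isSpaceOp_tensor (B := B) ⟨q.1, hq⟩ a
  rw [hAq] at h1 h2
  refine ⟨⟨hasTimeDeriv_tensor hG ha hb q.1 hT0, hasTimeDeriv_tensor hG' hb hc q.1 hT0,
    h2, isSpaceSqrt_tensor h1 a, isSpaceSqrt_tensor h1 b⟩, ?_⟩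
  exact isSmoothDirichlet_tensor hG h0 hT ha hr hqr

end Graphs

/-! ### Generators of reversible semigroups with a Poincaré inequality -/

section Generator

variable {X : Type*} [MeasurableSpace X] {μ : Measure X} [IsProbabilityMeasure μ]
  (Q : ReversibleSemigroup μ)

theorem hasGenerator_generator (f : Q.generator.domain) : Q.HasGenerator f (Q.generator f) :=
  f.2.choose_spec

theorem generator_eq {f l : Lp ℝ 2 μ} (h : Q.HasGenerator f l) :
    ∃ hf : f ∈ Q.generator.domain, Q.generator ⟨f, hf⟩ = l :=
  ⟨⟨l, h⟩, (hasGenerator_generator Q ⟨f, ⟨l, h⟩⟩).unique h⟩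

theorem inner_generator_left (f g : Q.generator.domain) :
    inner ℝ (Q.generator f) (g : Lp ℝ 2 μ) = inner ℝ (f : Lp ℝ 2 μ) (Q.generator g) := by
  have h1 := Filter.Tendsto.inner (𝕜 := ℝ) (hasGenerator_generator Q f)
    (tendsto_const_nhds (x := (g : Lp ℝ 2 μ)))
  have h2 := Filter.Tendsto.inner (𝕜 := ℝ) (tendsto_const_nhds (x := (f : Lp ℝ 2 μ)))
    (hasGenerator_generator Q g)
  refine tendsto_nhds_unique (h1.congr fun t => ?_) h2
  rw [inner_smul_left, inner_smul_right, inner_sub_left, inner_sub_right, Q.symm']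
  rfl

theorem generator_const (c : ℝ) :
    ∃ h : c • Lp.const 2 μ (1 : ℝ) ∈ Q.generator.domain,
      Q.generator ⟨c • Lp.const 2 μ (1 : ℝ), h⟩ = 0 := by
  refine generator_eq Q ?_
  have : ∀ t : ℝ≥0, (t : ℝ)⁻¹ • (Q.P t (c • Lp.const 2 μ (1 : ℝ)) - c • Lp.const 2 μ (1 : ℝ))
      = 0 := fun t => by rw [map_smul, Q.one', sub_self, smul_zero]
  simp only [ReversibleSemigroup.HasGenerator, this]
  exact tendsto_const_nhds

theorem energy_le_preForm {H : Type*} [NormedAddCommGroup H] [InnerProductSpace ℝ H]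
    (A : H →ₗ.[ℝ] H) (u : A.domain) : energy A (u : H) ≤ ENNReal.ofReal (preForm A u) := by
  refine iInf₂_le (preForm A u) ⟨fun _ => u, ⟨tendsto_const_nhds, ?_⟩, tendsto_const_nhds⟩
  simp only [sub_self]
  simp [preForm]

theorem eq_const_of_energy_eq_zero {A : Lp ℝ 2 μ →ₗ.[ℝ] Lp ℝ 2 μ} {m : ℝ}
    (hP : PoincareInequality μ A m) {f : Lp ℝ 2 μ} (h : energy A f = 0) :
    ∃ c : ℝ, f = c • Lp.const 2 μ (1 : ℝ) := by
  have h1 := hP f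
  rw [h, mul_zero, nonpos_iff_eq_zero, ENNReal.ofReal_eq_zero] at h1
  set c := ∫ y, f y ∂μ with hc
  have hm : MemLp (fun x => f x - c) 2 μ := (Lp.memLp f).sub (memLp_const c)
  have h2 : (fun x => (f x - c) ^ 2) =ᵐ[μ] 0 :=
    (integral_eq_zero_iff_of_nonneg (fun x => sq_nonneg _)
      ((memLp_two_iff_integrable_sq hm.1).1 hm)).1
      (le_antisymm h1 (integral_nonneg fun x => sq_nonneg _))
  refine ⟨c, Lp.ext ?_⟩
  filter_upwards [h2, Lp.coeFn_smul c (Lp.const 2 μ (1 : ℝ)), Lp.coeFn_const 2 μ (1 : ℝ)]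
    with x hx h3 h4
  rw [h3, Pi.smul_apply, h4, Function.const_apply, smul_eq_mul, mul_one]
  have : f x - c = 0 := by simpa using hx
  linarith

/-- By the Poincaré inequality, a vector of negative form would be constant, but constants have
form zero. -/
theorem preForm_generator_nonneg {m : ℝ} (hP : PoincareInequality μ Q.generator m)
    (u : Q.generator.domain) : 0 ≤ preForm Q.generator u := by
  by_contra! hneg
  have h0 : energy Q.generator (u : Lp ℝ 2 μ) = 0 := by
    have := energy_le_preForm Q.generator u
    rwa [ENNReal.ofReal_of_nonpos hneg.le, nonpos_iff_eq_zero] at this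
  obtain ⟨c, hc⟩ := eq_const_of_energy_eq_zero hP h0
  obtain ⟨h1, h2⟩ := generator_const Q (μ := μ) c
  have h3 : u = ⟨c • Lp.const 2 μ (1 : ℝ), h1⟩ := Subtype.ext hc
  rw [h3, preForm, h2, inner_zero_right, neg_zero] at hneg
  exact lt_irrefl _ hneg

variable {Q} {ι : Type*}

theorem energy_basis_le (B : EigenBasis Q.generator ι) (i : ι) :
    energy Q.generator (B.basis i) ≤ ENNReal.ofReal (B.lam i) := by
  obtain ⟨h1, h2⟩ := B.basis_mem i
  refine (energy_le_preForm Q.generator ⟨B.basis i, h1⟩).trans (le_of_eq ?_)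
  rw [preForm, h2, inner_smul_right, real_inner_self_eq_norm_sq, B.basis.orthonormal.1 i]
  simp

theorem basis_eq_const {m : ℝ} (hP : PoincareInequality μ Q.generator m)
    (B : EigenBasis Q.generator ι) {i : ι} (hi : B.lam i = 0) :
    ∃ c : ℝ, B.basis i = c • Lp.const 2 μ (1 : ℝ) := by
  refine eq_const_of_energy_eq_zero hP ?_
  have := energy_basis_le B i
  rwa [hi, ENNReal.ofReal_zero, nonpos_iff_eq_zero] at this

/-- The spectral gap. -/
theorem lam_eq_zero_or_le {m : ℝ} (hm : 0 < m) (hP : PoincareInequality μ Q.generator m)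
    (B : EigenBasis Q.generator ι) (i : ι) : B.lam i = 0 ∨ m ≤ B.lam i := by
  by_cases hi : B.lam i = 0
  · exact Or.inl hi
  right
  -- An eigenvector for a nonzero eigenvalue has mean zero.
  have hmean : ∫ x, B.basis i x ∂μ = 0 := by
    obtain ⟨h1, h2⟩ := generator_const Q (μ := μ) 1
    have h3 := B.inner_apply i ⟨_, h1⟩
    rw [h2, inner_zero_right] at h3
    have h4 : inner ℝ (B.basis i) (Lp.const 2 μ (1 : ℝ)) = (0 : ℝ) := by
      simpa [hi] using h3
    rw [inner_eq_integral_mul] at h4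
    rw [← h4]
    refine integral_congr_ae ?_
    filter_upwards [Lp.coeFn_const 2 μ (1 : ℝ)] with x hx
    rw [hx]
    simp
  have h5 := (hP (B.basis i)).trans (mul_le_mul_right (energy_basis_le B i) _)
  rw [hmean] at h5
  simp only [sub_zero] at h5
  rw [← norm_sq_eq_integral_sq, B.basis.orthonormal.1 i, ← ENNReal.ofReal_mul (by positivity),
    ENNReal.ofReal_le_ofReal_iff (mul_nonneg (by positivity) (B.lam_nonneg i)), one_pow,
    div_mul_eq_mul_div, one_mul, le_div_iff₀ hm, one_mul] at h5
  exact h5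

end Generator

theorem Orthonormal.countable {H : Type*} [NormedAddCommGroup H] [InnerProductSpace ℝ H]
    [TopologicalSpace.SeparableSpace H] {ι : Type*} {e : ι → H} (he : Orthonormal ℝ e) :
    Countable ι := by
  rw [← Set.countable_univ_iff]
  refine Set.PairwiseDisjoint.countable_of_isOpen (s := fun i => Metric.ball (e i) (1 / 2)) ?_
    (fun i _ => Metric.isOpen_ball) fun i _ => ⟨e i, Metric.mem_ball_self (by norm_num)⟩
  intro i _ j _ hij
  refine Metric.ball_disjoint_ball ?_
  have h1 : ‖e i - e j‖ ^ 2 = 2 := by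
    rw [norm_sub_sq_real, he.1 i, he.1 j, he.2 hij]
    norm_num
  rw [dist_eq_norm]
  nlinarith [norm_nonneg (e i - e j)]

/-! ### Solution of the divergence equation -/

theorem norm_smul_le_of_le {F : Type*} [NormedAddCommGroup F] [NormedSpace ℝ F] {s b K : ℝ} {x : F}
    (hs : 0 ≤ s) (hx : ‖x‖ ≤ b) (h : s * b ≤ K) : ‖s • x‖ ≤ K := by
  rw [norm_smul, Real.norm_of_nonneg hs]
  exact (mul_le_mul_of_nonneg_left hx hs).trans h

/-- The number `⌊α T⌋ + 1` of cells makes their length comparable to `min (1 / α, T)`. -/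
theorem cell_length_bounds {α T : ℝ} (hα : 0 ≤ α) (hT : 0 < T) {ℓ : ℝ}
    (hℓ : ℓ = T / ((⌊α * T⌋₊ + 1 : ℕ) : ℝ)) :
    0 < ℓ ∧ ((⌊α * T⌋₊ + 1 : ℕ) : ℝ) * ℓ = T ∧ α * ℓ ≤ 1 ∧ ℓ⁻¹ ≤ α + T⁻¹ ∧ ℓ ≤ T := by
  have h1 : α * T < ((⌊α * T⌋₊ + 1 : ℕ) : ℝ) := by
    push_cast
    exact Nat.lt_floor_add_one _
  have h2 : ((⌊α * T⌋₊ + 1 : ℕ) : ℝ) ≤ α * T + 1 := by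
    push_cast
    gcongr
    exact Nat.floor_le (by positivity)
  have h3 : (1 : ℝ) ≤ ((⌊α * T⌋₊ + 1 : ℕ) : ℝ) := by
    push_cast
    linarith [Nat.cast_nonneg (α := ℝ) ⌊α * T⌋₊]
  set N : ℝ := ((⌊α * T⌋₊ + 1 : ℕ) : ℝ) with hN
  have hN0 : 0 < N := by linarith
  subst hℓ
  refine ⟨by positivity, by field_simp, ?_, ?_, div_le_self hT.le h3⟩
  · rw [mul_div_assoc', div_le_one hN0]
    exact h1.le
  · rw [inv_div, div_le_iff₀ hT, add_mul, inv_mul_cancel₀ hT.ne']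
    exact h2

/-- Bounds on the coefficient `κ = 1 / (2 lam)` of `g`; by convention `κ = 0` for `lam = 0`. -/
theorem mode_coefficient_bounds {lam m : ℝ} (hm : 0 < m) (h : lam = 0 ∨ m ≤ lam) :
    0 ≤ (2 * lam)⁻¹ ∧ (2 * lam)⁻¹ ≤ (2 * m)⁻¹ ∧ (2 * lam)⁻¹ * lam ≤ 1 / 2 ∧
      (2 * lam)⁻¹ * √lam ≤ 1 / 2 * (√m)⁻¹ := by
  rcases h with rfl | h
  · simp only [mul_zero, inv_zero, zero_mul]
    exact ⟨le_rfl, by positivity, by norm_num, by positivity⟩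
  · have hl : 0 < lam := hm.trans_le h
    refine ⟨by positivity, by gcongr, le_of_eq (by field_simp), ?_⟩
    have h1 : (2 * lam)⁻¹ * √lam = 1 / 2 * (√lam)⁻¹ := by
      have : lam = √lam * √lam := (Real.mul_self_sqrt hl.le).symm
      have h0 : √lam ≠ 0 := (Real.sqrt_pos.2 hl).ne'
      nth_rewrite 1 [this]
      field_simp
    rw [h1]
    gcongr

theorem two_mul_timeEnergy_rpow_le {X : Type*} [MeasurableSpace X] {μ : Measure X} [SFinite μ]
    {T : ℝ} {A : Lp ℝ 2 μ →ₗ.[ℝ] Lp ℝ 2 μ} {ι : Type*} [Countable ι] {B : EigenBasis A ι}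
    {u w : Lp ℝ 2 (spaceTime T μ)} (h : IsSpaceSqrt B u w) {K : ℝ} (hw : 2 * ‖w‖ ≤ K) :
    (2 * timeEnergy A u) ^ (1 / 2 : ℝ) ≤ ENNReal.ofReal K := by
  have h1 : 2 * timeEnergy A u ≤ (2 * ‖w‖ₑ) ^ 2 := by
    rw [mul_pow]
    refine mul_le_mul' ?_ (timeEnergy_le h)
    norm_num
  calc (2 * timeEnergy A u) ^ (1 / 2 : ℝ) ≤ ((2 * ‖w‖ₑ) ^ 2) ^ (1 / 2 : ℝ) :=
        ENNReal.rpow_le_rpow h1 (by norm_num)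
    _ = 2 * ‖w‖ₑ := by
        rw [← ENNReal.rpow_natCast, ← ENNReal.rpow_mul]
        norm_num
    _ = ENNReal.ofReal (2 * ‖w‖) := by
        rw [ENNReal.ofReal_mul (by norm_num), ofReal_norm]
        norm_num
    _ ≤ _ := ENNReal.ofReal_le_ofReal hw

/-- The operators solving the divergence equation on the modes with eigenvalue `lam`. Here `κ J`,
`κ J₁` and `κ J₂` give `g`, `∂ₜ g` and `∂ₜₜ g`, while `S` and `1 - J` give `h` and `∂ₜ h`. The
bounds with explicit constants are the asserted estimates, those by `K` only serve to define the
operators on `L²(λ ⊗ μ)`. -/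
structure IsModeSolver (T m c₀ c₁ K lam κ : ℝ) (J J₁ J₂ S : TimeL2 T →L[ℝ] TimeL2 T) : Prop where
  norm_S : ‖S‖ ≤ K
  norm_one_sub_J : ‖ContinuousLinearMap.id ℝ (TimeL2 T) - J‖ ≤ K
  norm_sqrt_S : ‖√lam • S‖ ≤ 1 + c₀
  norm_J : ‖κ • J‖ ≤ K
  norm_J₁ : ‖κ • J₁‖ ≤ K
  norm_J₂ : ‖κ • J₂‖ ≤ K
  norm_lam_J : ‖κ • (-lam) • J‖ ≤ 1 / 2 * c₀
  norm_sqrt_J : ‖κ • √lam • J‖ ≤ K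
  norm_sqrt_J₁ : ‖κ • √lam • J₁‖ ≤ 1 / 2 * (1 + T⁻¹ * (√m)⁻¹) * c₁
  exists_smooth_J : ∀ f, ∃ G : ℝ → ℝ, ContDiff ℝ ∞ G ∧ G 0 = 0 ∧ G T = 0 ∧
    J f =ᵐ[(volume : Measure ℝ).restrict (Icc 0 T)] G ∧
    J₁ f =ᵐ[(volume : Measure ℝ).restrict (Icc 0 T)] deriv G ∧
    J₂ f =ᵐ[(volume : Measure ℝ).restrict (Icc 0 T)] deriv (deriv G)
  exists_smooth_S : ∀ (f : TimeL2 T) (F : ℝ → ℝ), ContDiff ℝ ∞ F →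
    f =ᵐ[(volume : Measure ℝ).restrict (Icc 0 T)] F → ∃ G : ℝ → ℝ, ContDiff ℝ ∞ G ∧ G 0 = 0 ∧
    G T = 0 ∧ S f =ᵐ[(volume : Measure ℝ).restrict (Icc 0 T)] G ∧
    (f - J f : TimeL2 T) =ᵐ[(volume : Measure ℝ).restrict (Icc 0 T)] deriv G
  J_eq_zero : lam = 0 → ∀ f : TimeL2 T, ∫ t in Icc 0 T, f t = 0 → J f = 0
  two_mul_κ : lam ≠ 0 → 2 * (κ * lam) = 1

/-- The bounds hold uniformly in `lam`, since the length of the cells is adapted to it. -/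
theorem exists_modeSolver {m T c₀ c₁ c₂ : ℝ} (hm : 0 < m) (hT : 0 < T) (hc₀ : 0 ≤ c₀)
    (hc₁ : 0 ≤ c₁) (hc₂ : 0 ≤ c₂)
    (hsol : ∀ (ℓ : ℝ) (N : ℕ), 0 < ℓ → N * ℓ = T →
      ∃ J J₁ J₂ S : TimeL2 T →L[ℝ] TimeL2 T, IsLocalSolver T ℓ c₀ c₁ c₂ J J₁ J₂ S) :
    ∃ K, 0 ≤ K ∧ ∀ lam : ℝ, 0 ≤ lam → lam = 0 ∨ m ≤ lam →
      ∃ (κ : ℝ) (J J₁ J₂ S : TimeL2 T →L[ℝ] TimeL2 T),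
        IsModeSolver T m c₀ c₁ K lam κ J J₁ J₂ S := by
  obtain ⟨K, hK⟩ := Finset.exists_le ({0, T * (1 + c₀), 1 + c₀, (2 * m)⁻¹ * c₀,
    ((2 * m)⁻¹ + 1 / 2 + (2 * m)⁻¹ * T⁻¹) * c₁, (1 + 2 * (2 * m)⁻¹ * T⁻¹ ^ 2) * c₂,
    ((2 * m)⁻¹ + 1 / 2) * c₀} : Finset ℝ)
  simp only [Finset.mem_insert, Finset.mem_singleton, forall_eq_or_imp, forall_eq] at hK
  obtain ⟨hK0, hKS, hK1, hKJ, hKJ₁, hKJ₂, hKsJ⟩ := hK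
  refine ⟨K, hK0, fun lam hlam hgap => ?_⟩
  obtain ⟨α, hα⟩ : ∃ α, α = √lam := ⟨_, rfl⟩
  obtain ⟨κ, hκ⟩ : ∃ κ, κ = (2 * lam)⁻¹ := ⟨_, rfl⟩
  obtain ⟨ℓ, hℓ⟩ : ∃ ℓ, ℓ = T / ((⌊α * T⌋₊ + 1 : ℕ) : ℝ) := ⟨_, rfl⟩
  have hα0 : 0 ≤ α := hα ▸ Real.sqrt_nonneg _
  have hα2 : α * α = lam := hα ▸ Real.mul_self_sqrt hlam
  obtain ⟨hℓ0, hNℓ, hαℓ, hℓα, hℓT⟩ := cell_length_bounds hα0 hT hℓ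
  obtain ⟨hκ0, hκm, hκlam, hκα'⟩ := mode_coefficient_bounds hm hgap
  rw [← hκ] at hκ0 hκm hκlam hκα'
  rw [← hα] at hκα'
  obtain ⟨J, J₁, J₂, S, hP⟩ := hsol ℓ _ hℓ0 hNℓ
  have hℓi : 0 ≤ ℓ⁻¹ := inv_nonneg.2 hℓ0.le
  have hκα : κ * α ≤ (2 * m)⁻¹ + 1 / 2 := by
    have : α ≤ 1 + lam := by nlinarith [sq_nonneg (α - 1)]
    calc κ * α ≤ κ * (1 + lam) := mul_le_mul_of_nonneg_left this hκ0
      _ ≤ _ := by rw [mul_add, mul_one]; exact add_le_add hκm hκlam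
  have hκℓ : κ * ℓ⁻¹ ≤ (2 * m)⁻¹ + 1 / 2 + (2 * m)⁻¹ * T⁻¹ :=
    calc κ * ℓ⁻¹ ≤ κ * (α + T⁻¹) := mul_le_mul_of_nonneg_left hℓα hκ0
      _ = κ * α + κ * T⁻¹ := mul_add _ _ _
      _ ≤ _ := add_le_add hκα (mul_le_mul_of_nonneg_right hκm (by positivity))
  have hκℓ2 : κ * (ℓ⁻¹ * ℓ⁻¹) ≤ 1 + 2 * (2 * m)⁻¹ * T⁻¹ ^ 2 := by
    have h4 : ℓ⁻¹ * ℓ⁻¹ ≤ (α + T⁻¹) * (α + T⁻¹) := mul_self_le_mul_self hℓi hℓα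
    have h5 : ℓ⁻¹ * ℓ⁻¹ ≤ 2 * lam + 2 * T⁻¹ ^ 2 := by nlinarith [sq_nonneg (α - T⁻¹)]
    have h6 := mul_le_mul_of_nonneg_right hκm (sq_nonneg T⁻¹)
    have h7 := mul_le_mul_of_nonneg_left h5 hκ0
    linarith
  have hκαℓ : κ * (α * ℓ⁻¹) ≤ 1 / 2 * (1 + T⁻¹ * (√m)⁻¹) := by
    have h1 : κ * (α * ℓ⁻¹) ≤ κ * (α * (α + T⁻¹)) :=
      mul_le_mul_of_nonneg_left (mul_le_mul_of_nonneg_left hℓα hα0) hκ0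
    have h2 : κ * (α * (α + T⁻¹)) = κ * lam + κ * α * T⁻¹ := by rw [← hα2]; ring
    have h3 := mul_le_mul_of_nonneg_right hκα' (inv_nonneg.2 hT.le)
    linarith
  have hlamJ : ‖(-lam) • J‖ ≤ lam * c₀ := by
    rw [neg_smul, norm_neg]
    exact norm_smul_le_of_le hlam hP.norm_J le_rfl
  refine ⟨κ, J, J₁, J₂, S, ⟨?_, ?_, ?_, ?_, ?_, ?_, ?_, ?_, ?_, hP.exists_smooth_J,
    hP.exists_smooth_S, fun h0 => hP.J_eq_zero ?_, fun h0 => ?_⟩⟩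
  · exact hP.norm_S.trans ((mul_le_mul_of_nonneg_right hℓT (by positivity)).trans hKS)
  · exact ((norm_sub_le _ _).trans
      (add_le_add ContinuousLinearMap.norm_id_le hP.norm_J)).trans hK1
  · rw [← hα]
    refine norm_smul_le_of_le hα0 hP.norm_S ?_
    rw [← mul_assoc]
    exact mul_le_of_le_one_left (by positivity) hαℓ
  · exact norm_smul_le_of_le hκ0 hP.norm_J ((mul_le_mul_of_nonneg_right hκm hc₀).trans hKJ)
  · refine norm_smul_le_of_le hκ0 hP.norm_J₁ ?_
    rw [← mul_assoc]
    exact (mul_le_mul_of_nonneg_right hκℓ hc₁).trans hKJ₁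
  · refine norm_smul_le_of_le hκ0 hP.norm_J₂ ?_
    rw [← mul_assoc ℓ⁻¹, ← mul_assoc]
    exact (mul_le_mul_of_nonneg_right hκℓ2 hc₂).trans hKJ₂
  · refine norm_smul_le_of_le hκ0 hlamJ ?_
    rw [← mul_assoc]
    exact mul_le_mul_of_nonneg_right hκlam hc₀
  · have h1 : ‖√lam • J‖ ≤ α * c₀ := hα ▸ norm_smul_le_of_le hα0 hP.norm_J le_rfl
    refine norm_smul_le_of_le hκ0 h1 ?_
    rw [← mul_assoc]
    exact (mul_le_mul_of_nonneg_right hκα hc₀).trans hKsJ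
  · have h1 : ‖√lam • J₁‖ ≤ α * (ℓ⁻¹ * c₁) := hα ▸ norm_smul_le_of_le hα0 hP.norm_J₁ le_rfl
    refine norm_smul_le_of_le hκ0 h1 ?_
    rw [← mul_assoc α, ← mul_assoc]
    exact mul_le_mul_of_nonneg_right hκαℓ hc₁
  · rw [hℓ, hα, h0]
    simp
  · rw [hκ]
    field_simp

section Solution

variable {d : ℕ} {S : Set (EuclideanSpace ℝ (Fin d))} {μ : Measure (EuclideanSpace ℝ (Fin d))}
  [SFinite μ] {T : ℝ} {A : Lp ℝ 2 μ →ₗ.[ℝ] Lp ℝ 2 μ} {ι : Type*} [Countable ι] {B : EigenBasis A ι}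

theorem mem_closedGraph12_of_modes (hcore : SmoothCore S A) (hT : 0 < T)
    {D D₁ Ds : Lp ℝ 2 (spaceTime T μ) →L[ℝ] Lp ℝ 2 (spaceTime T μ)}
    (P J : ι → TimeL2 T →L[ℝ] TimeL2 T)
    (hD : ∀ i φ, D (mode B.basis T i φ) = mode B.basis T i (P i φ))
    (hD₁ : ∀ i φ, D₁ (mode B.basis T i φ) = mode B.basis T i (φ - J i φ))
    (hDs : ∀ i φ, Ds (mode B.basis T i φ) = mode B.basis T i (√(B.lam i) • P i φ))
    (hP : ∀ i (φ : TimeL2 T) (F : ℝ → ℝ), ContDiff ℝ ∞ F →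
      φ =ᵐ[(volume : Measure ℝ).restrict (Icc 0 T)] F → ∃ G : ℝ → ℝ, ContDiff ℝ ∞ G ∧ G 0 = 0 ∧
      G T = 0 ∧ P i φ =ᵐ[(volume : Measure ℝ).restrict (Icc 0 T)] G ∧
      (φ - J i φ : TimeL2 T) =ᵐ[(volume : Measure ℝ).restrict (Icc 0 T)] deriv G)
    (f : Lp ℝ 2 (spaceTime T μ)) : ![D f, D₁ f, Ds f] ∈ closedGraph12 S B T := by
  have h0 := forall_mem_of_isHilbertSum (isHilbertSum_mode (T := T) B.basis) (closedGraph12 S B T)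
    (Submodule.isClosed_topologicalClosure _) (ContinuousLinearMap.pi ![D, D₁, Ds])
    (Lp.dense_hasCompactSupport_contDiff (by simp)) ?_ f
  · convert h0 using 1
    ext1 k
    fin_cases k <;> rfl
  rintro i φ ⟨F, hφF, -, hF⟩
  obtain ⟨G, hG, hG0, hGT, h1, h2⟩ := hP i φ F hF hφF
  convert tensor_mem_closedGraph12 hcore hT.le hG hG0 hGT h1 h2 i (B := B) (S := S) using 1
  ext1 k
  fin_cases k
  · exact hD i φ
  · exact hD₁ i φ
  · exact hDs i φ

theorem mem_closedGraph22_of_modes (hcore : SmoothCore S A) (hT : 0 < T)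
    {D D₁ D₂ Dw Ds Ds₁ : Lp ℝ 2 (spaceTime T μ) →L[ℝ] Lp ℝ 2 (spaceTime T μ)}
    (κ : ι → ℝ) (J J₁ J₂ : ι → TimeL2 T →L[ℝ] TimeL2 T)
    (hD : ∀ i φ, D (mode B.basis T i φ) = mode B.basis T i (κ i • J i φ))
    (hD₁ : ∀ i φ, D₁ (mode B.basis T i φ) = mode B.basis T i (κ i • J₁ i φ))
    (hD₂ : ∀ i φ, D₂ (mode B.basis T i φ) = mode B.basis T i (κ i • J₂ i φ))
    (hDw : ∀ i φ, Dw (mode B.basis T i φ) = mode B.basis T i (κ i • (-B.lam i) • J i φ))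
    (hDs : ∀ i φ, Ds (mode B.basis T i φ) = mode B.basis T i (κ i • √(B.lam i) • J i φ))
    (hDs₁ : ∀ i φ, Ds₁ (mode B.basis T i φ) = mode B.basis T i (κ i • √(B.lam i) • J₁ i φ))
    (hJ : ∀ i φ, ∃ G : ℝ → ℝ, ContDiff ℝ ∞ G ∧ G 0 = 0 ∧ G T = 0 ∧
      J i φ =ᵐ[(volume : Measure ℝ).restrict (Icc 0 T)] G ∧
      J₁ i φ =ᵐ[(volume : Measure ℝ).restrict (Icc 0 T)] deriv G ∧
      J₂ i φ =ᵐ[(volume : Measure ℝ).restrict (Icc 0 T)] deriv (deriv G))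
    (f : Lp ℝ 2 (spaceTime T μ)) :
    ![D f, D₁ f, D₂ f, Dw f, Ds f, Ds₁ f] ∈ closedGraph22 S B T := by
  have h0 := forall_mem_of_isHilbertSum (isHilbertSum_mode (T := T) B.basis) (closedGraph22 S B T)
    (Submodule.isClosed_topologicalClosure _) (ContinuousLinearMap.pi ![D, D₁, D₂, Dw, Ds, Ds₁])
    dense_univ ?_ f
  · convert h0 using 1
    ext1 k
    fin_cases k <;> rfl
  rintro i φ -
  obtain ⟨G, hG, hG0, hGT, h1, h2, h3⟩ := hJ i φ
  convert Submodule.smul_mem _ (κ i)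
    (tensor_mem_closedGraph22 hcore hT.le hG hG0 hGT h1 h2 h3 i (B := B) (S := S)) using 1
  ext1 k
  fin_cases k
  · exact (hD i φ).trans (map_smul (mode B.basis T i) _ _)
  · exact (hD₁ i φ).trans (map_smul (mode B.basis T i) _ _)
  · exact (hD₂ i φ).trans (map_smul (mode B.basis T i) _ _)
  · exact (hDw i φ).trans (map_smul (mode B.basis T i) _ _)
  · exact (hDs i φ).trans (map_smul (mode B.basis T i) _ _)
  · exact (hDs₁ i φ).trans (map_smul (mode B.basis T i) _ _)

/-- With `D₁` the operator `f ↦ ∂ₜ h` and `Dw` the operator `f ↦ A g`, the equation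
`∂ₜ h - 2 A g = f` holds mode by mode. For the modes with eigenvalue zero, `g` does not contribute,
and `f` is required to have vanishing time average there. -/
theorem divergence_eq_of_modes {D₁ Dw : Lp ℝ 2 (spaceTime T μ) →L[ℝ] Lp ℝ 2 (spaceTime T μ)}
    (κ : ι → ℝ) (J : ι → TimeL2 T →L[ℝ] TimeL2 T)
    (hD₁ : ∀ i φ, D₁ (mode B.basis T i φ) = mode B.basis T i (φ - J i φ))
    (hDw : ∀ i φ, Dw (mode B.basis T i φ) = mode B.basis T i (κ i • (-B.lam i) • J i φ))
    (hκ : ∀ i, B.lam i ≠ 0 → 2 * (κ i * B.lam i) = 1) (f : Lp ℝ 2 (spaceTime T μ))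
    (hf : ∀ i, B.lam i = 0 → J i (coef (B.basis i) f) = 0) :
    D₁ f - (2 : ℝ) • Dw f = f := by
  classical
  rw [← sub_eq_zero]
  refine eq_zero_of_coef_eq_zero B.basis fun j => ?_
  -- The `j`-th coefficient of the defect is `-J j` of that of `f` if `lam j = 0`, and `0` else.
  obtain ⟨s, hs⟩ : ∃ s : ℝ, s = if B.lam j = 0 then 1 else 0 := ⟨_, rfl⟩
  obtain ⟨R, hRdef⟩ : ∃ R : Lp ℝ 2 (spaceTime T μ) →L[ℝ] TimeL2 T, ∀ u,
      R u = coef (B.basis j) (D₁ u - (2 : ℝ) • Dw u - u) + s • J j (coef (B.basis j) u) :=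
    ⟨(coef (B.basis j)).comp (D₁ - (2 : ℝ) • Dw - ContinuousLinearMap.id ℝ _)
      + s • (J j).comp (coef (B.basis j)), fun u => rfl⟩
  have hR : R f ∈ (⊥ : Submodule ℝ (TimeL2 T)) := by
    refine forall_mem_of_isHilbertSum (isHilbertSum_mode (T := T) B.basis) ⊥ isClosed_singleton R
      dense_univ ?_ f
    rintro i φ -
    rw [Submodule.mem_bot, hRdef, hD₁, hDw, ← map_smul, ← map_sub, ← map_sub, coef_mode, coef_mode]
    split_ifs with hij
    · subst hij
      by_cases h0 : B.lam j = 0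
      · simp [hs, h0]
      · have h1 : (2 : ℝ) • κ j • (-B.lam j) • J j φ = -J j φ := by
          rw [smul_smul, smul_smul, ← neg_one_smul ℝ (J j φ)]
          congr 1
          linarith [hκ j h0]
        rw [h1, hs, if_neg h0]
        simp
    · simp
  rw [Submodule.mem_bot, hRdef] at hR
  have hJf : s • J j (coef (B.basis j) f) = 0 := by
    rw [hs]
    split_ifs with h0
    · rw [hf j h0, smul_zero]
    · rw [zero_smul]
  rwa [hJf, add_zero] at hR

/-- The tuple `p` is formed from `h`, the tuple `q` from `g`. -/
theorem exists_divergence_solution (hcore : SmoothCore S A)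
    {m : ℝ} (hm : 0 < m) (hgap : ∀ i, B.lam i = 0 ∨ m ≤ B.lam i) (hT : 0 < T) {c₀ c₁ c₂ : ℝ}
    (hc₀ : 0 ≤ c₀) (hc₁ : 0 ≤ c₁) (hc₂ : 0 ≤ c₂)
    (hsol : ∀ (ℓ : ℝ) (N : ℕ), 0 < ℓ → N * ℓ = T →
      ∃ J J₁ J₂ S : TimeL2 T →L[ℝ] TimeL2 T, IsLocalSolver T ℓ c₀ c₁ c₂ J J₁ J₂ S)
    (f : Lp ℝ 2 (spaceTime T μ))
    (hf : ∀ i, B.lam i = 0 → ∫ t in Icc 0 T, (coef (B.basis i) f : TimeL2 T) t = 0) :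
    ∃ p ∈ closedGraph12 S B T, ∃ q ∈ closedGraph22 S B T, p 1 - (2 : ℝ) • q 3 = f ∧
      ‖p 2‖ ≤ (1 + c₀) * ‖f‖ ∧ ‖q 3‖ ≤ 1 / 2 * c₀ * ‖f‖ ∧
      ‖q 5‖ ≤ 1 / 2 * (1 + T⁻¹ * (√m)⁻¹) * c₁ * ‖f‖ := by
  obtain ⟨K, hK, hex⟩ := exists_modeSolver hm hT hc₀ hc₁ hc₂ hsol
  choose κ J J₁ J₂ P hP using fun i => hex (B.lam i) (B.lam_nonneg i) (hgap i)
  have hdiag : ∀ (b : ι → TimeL2 T →L[ℝ] TimeL2 T) (K : ℝ), 0 ≤ K → (∀ i, ‖b i‖ ≤ K) →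
      ∃ D : Lp ℝ 2 (spaceTime T μ) →L[ℝ] Lp ℝ 2 (spaceTime T μ), ‖D‖ ≤ K ∧
        ∀ i φ, D (mode B.basis T i φ) = mode B.basis T i (b i φ) :=
    fun b K hK hb => exists_diagonal (isHilbertSum_mode (T := T) B.basis) b hK hb
  -- In the names, `d` stands for `∂ₜ` and `s` for `√(-A)`; `Dw` yields `A g`.
  obtain ⟨Dh, -, hDh⟩ := hdiag _ K hK fun i => (hP i).norm_S
  obtain ⟨Ddh, -, hDdh⟩ := hdiag _ K hK fun i => (hP i).norm_one_sub_J
  obtain ⟨Dsh, hDshn, hDsh⟩ := hdiag _ (1 + c₀) (by positivity) fun i => (hP i).norm_sqrt_S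
  obtain ⟨Dg, -, hDg⟩ := hdiag _ K hK fun i => (hP i).norm_J
  obtain ⟨Ddg, -, hDdg⟩ := hdiag _ K hK fun i => (hP i).norm_J₁
  obtain ⟨Dddg, -, hDddg⟩ := hdiag _ K hK fun i => (hP i).norm_J₂
  obtain ⟨Dw, hDwn, hDw⟩ := hdiag _ (1 / 2 * c₀) (by positivity) fun i => (hP i).norm_lam_J
  obtain ⟨Dsg, -, hDsg⟩ := hdiag _ K hK fun i => (hP i).norm_sqrt_J
  obtain ⟨Dsdg, hDsdgn, hDsdg⟩ := hdiag _ (1 / 2 * (1 + T⁻¹ * (√m)⁻¹) * c₁) (by positivity)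
    fun i => (hP i).norm_sqrt_J₁
  have h12 := mem_closedGraph12_of_modes hcore hT P J hDh hDdh hDsh
    (fun i => (hP i).exists_smooth_S) f
  have h22 := mem_closedGraph22_of_modes hcore hT κ J J₁ J₂ hDg hDdg hDddg hDw hDsg hDsdg
    (fun i => (hP i).exists_smooth_J) f
  have heq := divergence_eq_of_modes κ J hDdh hDw (fun i => (hP i).two_mul_κ) f
    fun i hi => (hP i).J_eq_zero hi _ (hf i hi)
  exact ⟨_, h12, _, h22, heq, Dsh.le_of_opNorm_le hDshn f, Dw.le_of_opNorm_le hDwn f,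
    Dsdg.le_of_opNorm_le hDsdgn f⟩

end Solution

/-- If `f` has mean zero, then so does its component along the constants. -/
theorem integral_coef_eq_zero {X : Type*} [MeasurableSpace X] {μ : Measure X}
    [IsProbabilityMeasure μ] {T : ℝ} {f : Lp ℝ 2 (spaceTime T μ)}
    (hf : ∫ z, f z ∂(spaceTime T μ) = 0) (c : ℝ) :
    ∫ t in Icc 0 T, (coef (c • Lp.const 2 μ (1 : ℝ)) f : TimeL2 T) t = 0 := by
  obtain ⟨φ, hφ⟩ : ∃ φ : TimeL2 T, φ =ᵐ[volume.restrict (Icc 0 T)] fun _ => (1 : ℝ) :=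
    ⟨(memLp_const 1).toLp _, MemLp.coeFn_toLp _⟩
  have hψ : ⇑(c • Lp.const 2 μ (1 : ℝ)) =ᵐ[μ] fun _ => c := by
    filter_upwards [Lp.coeFn_smul c (Lp.const 2 μ (1 : ℝ)), Lp.coeFn_const 2 μ (1 : ℝ)] with x h h'
    rw [h, Pi.smul_apply, h']
    simp
  have h1 : ∫ t in Icc 0 T, (coef (c • Lp.const 2 μ (1 : ℝ)) f : TimeL2 T) t
      = inner ℝ φ (coef (c • Lp.const 2 μ (1 : ℝ)) f) := by
    rw [inner_eq_integral_mul]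
    refine integral_congr_ae ?_
    filter_upwards [hφ] with t ht
    rw [ht, one_mul]
  have h2 : ⇑(tensor (volume.restrict (Icc 0 T)) μ φ (c • Lp.const 2 μ (1 : ℝ)))
      =ᵐ[spaceTime T μ] fun _ => 1 * c :=
    (coeFn_tensor φ _).trans (prod_mul_ae_eq hφ hψ)
  have h3 : inner ℝ φ (coef (c • Lp.const 2 μ (1 : ℝ)) f)
      = inner ℝ (tensor (volume.restrict (Icc 0 T)) μ φ (c • Lp.const 2 μ (1 : ℝ))) f :=
    inner_coef _ _ _
  rw [h1, h3, inner_eq_integral_mul]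
  have h4 : ∫ z, (1 * c) * f z ∂(spaceTime T μ) = 0 := by
    rw [integral_const_mul, hf, mul_zero]
  refine Eq.trans (integral_congr_ae ?_) h4
  filter_upwards [h2] with z hz
  rw [hz]

end DivLemma

end

theorem lemma3p6 :
    ∃ C : ℝ, 0 < C ∧
      ∀ (d : ℕ) (S : Set (EuclideanSpace ℝ (Fin d)))
        (μ : Measure (EuclideanSpace ℝ (Fin d))) [IsProbabilityMeasure μ]
        (_hS : ∀ᵐ x ∂μ, x ∈ S)
        (Q : DivLemma.ReversibleSemigroup μ)
        (_hcore : DivLemma.SmoothCore S Q.generator)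
        (_hdisc : DivLemma.HasPurelyDiscreteSpectrum Q.generator)
        (m : ℝ) (_hm : 0 < m) (_hP : DivLemma.PoincareInequality μ Q.generator m)
        (T : ℝ) (_hT : 0 < T)
        (f : Lp ℝ 2 (DivLemma.spaceTime T μ))
        (_hf : ∫ z, f z ∂(DivLemma.spaceTime T μ) = 0),
        ∃ h ∈ DivLemma.sobolev12 (T := T) S Q.generator,
        ∃ g ∈ DivLemma.sobolev22 (T := T) S Q.generator,
        ∃ dh Lg dg : Lp ℝ 2 (DivLemma.spaceTime T μ),
          DivLemma.HasTimeDeriv h dh ∧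
          DivLemma.HasSpaceOp Q.generator g Lg ∧
          DivLemma.HasTimeDeriv g dg ∧
          dh - (2 : ℝ) • Lg = f ∧
          ‖(2 : ℝ) • Lg‖ ≤ C * ‖f‖ ∧
          (2 * DivLemma.timeEnergy Q.generator h) ^ (1 / 2 : ℝ)
            ≤ ENNReal.ofReal (C * ‖f‖) ∧
          (2 * DivLemma.timeEnergy Q.generator dg) ^ (1 / 2 : ℝ)
            ≤ ENNReal.ofReal (C * (1 + T⁻¹ * (Real.sqrt m)⁻¹) * ‖f‖) := by
  obtain ⟨c₀, c₁, c₂, hc₀, hc₁, hc₂, hsol⟩ := DivLemma.exists_localSolver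
  refine ⟨2 * (1 + c₀ + c₁), by positivity, ?_⟩
  intro d S μ _ _ Q hcore hdisc m hm hP T hT f hf
  obtain ⟨ι, ⟨B⟩⟩ := DivLemma.exists_eigenBasis (DivLemma.inner_generator_left Q)
    (DivLemma.preForm_generator_nonneg Q hP) hdisc
  have : Fact ((2 : ℝ≥0∞) ≠ ⊤) := ⟨by simp⟩
  have : Countable ι := DivLemma.Orthonormal.countable B.basis.orthonormal
  obtain ⟨p, hp, q, hq, heq, h1, h2, h3⟩ := DivLemma.exists_divergence_solution hcore hm
    (DivLemma.lam_eq_zero_or_le hm hP B) hT hc₀ hc₁ hc₂ (hsol T) f fun i hi => by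
      obtain ⟨c, hc⟩ := DivLemma.basis_eq_const hP B hi
      rw [hc]
      exact DivLemma.integral_coef_eq_zero hf c
  have hp' := DivLemma.closedGraph12_le hp
  have hq' := DivLemma.closedGraph22_le hq
  have hf0 : 0 ≤ ‖f‖ := norm_nonneg f
  have hc₀f := mul_nonneg hc₀ hf0
  have hc₁f := mul_nonneg hc₁ hf0
  refine ⟨p 0, DivLemma.mem_sobolev12 hp, q 0, DivLemma.mem_sobolev22 hq, p 1, q 3, q 1, hp'.1,
    hq'.2.2.1.hasSpaceOp, hq'.1, heq, ?_, DivLemma.two_mul_timeEnergy_rpow_le hp'.2 ?_,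
    DivLemma.two_mul_timeEnergy_rpow_le hq'.2.2.2.2 ?_⟩
  · rw [norm_smul, Real.norm_of_nonneg zero_le_two]
    linarith
  · linarith
  · have h4 : 0 ≤ 1 + T⁻¹ * (√m)⁻¹ := by positivity
    have h5 := mul_nonneg h4 hf0
    have h6 := mul_nonneg hc₀ h5
    have h7 := mul_nonneg hc₁ h5
    linarith
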